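/- Let $N\ge 1$ be an integer and let $q_i^\alpha$ ($1\le\alpha\le N$, $0\le i\le N$) be real numbers. For $\hbar\in(0,1]$ set $q^\alpha=q^\alpha(\hbar)=\sum_{i=0}^N\hbar^i q_i^\alpha$, and let $Q^{(N)}$ be the closure in $L^2(\mathbb R)$ of the operator $\operatorname{Op}_\hbar^w\big(\sum_{\alpha=1}^N q^\alpha (x\xi)^\alpha\big)$ with domain the Schwartz space $\mathcal S(\mathbb R)$, where $$\operatorname{Op}_\hbar^w(a)u(x)=\frac1{2\pi\hbar}\int\!\!\int e^{i(x-y)\xi/\hbar}\,a\big(\tfrac{x+y}2,\xi\big)\,u(y)\,dy\,d\xi .$$ Let $\varphi_0(x)=(\pi\hbar)^{-1/4}e^{-x^2/2\hbar}$, let $\varphi_m=(m!)^{-1/2}(a^*)^m\varphi_0$ with $a^*=(2\hbar)^{-1/2}(x-\hbar\partial_x)$ be the normalized excited states, and let $\mathcal D_\beta u(x)=e^{-\beta/2}u(e^{-\beta}x)$ be the unitary dilation. Then $Q^{(N)}$ generates a strongly continuous unitary group $e^{-itQ^{(N)}/\hbar}$ on $L^2(\mathbb R)$ (whose infinitesimal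 generator is $-\frac{i}{\hbar}Q^{(N)}$). Moreover, for every $l\in\mathbb N=\{0,1,2,\dots\}$ and every $K$ there is a constant $C_l>0$, depending only on $N$, $l$ and $K$, such that whenever $|q_i^\alpha|\le K$ for all $2\le\alpha\le N$, $0\le i\le N$, there are polynomials $c_m(t,\hbar)$ in $(t,\hbar)$ with complex coefficients, $m\ge 0$, of degree at most $l$ in $t$, with $c_m=0$ for $m>Nl$, such that for all $\hbar\in(0,1]$ and all $t\in\mathbb R$ $$\Big\|e^{-itQ^{(N)}/\hbar}\varphi_0-\mathcal D_{tq^1}\varphi_0-\sum_{m=0}^{Nl}c_m(t,\hbar)\,\mathcal D_{tq^1}\varphi_{2m}\Big\|_{L^2}\le C_l\,(|t|\hbar)^{l+1},$$ and, if one keeps only the terms with $m\le 2l$, $$\Big\|e^{-itQ^{(N)}/\hbar}\varphi_0-\mathcal D_{tq^1}\varphi_0-\sum_{m=0}^{2l}c_m(t,\hbar)\,\mathcal D_{tq^1}\varphi_{2m}\Big\|_{L^2}\le C_l\,|t|\max(1,|t|^l)\,\hbar^{l+1},$$ the right-hand side of which is $C_l(|t|\hbar)^{l+1}$ for $|t|\ge1$.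 The coefficients satisfy, for all $\hbar\in(0,1]$, $t\in\mathbb R$, $$|c_m(t,\hbar)|\le C_l\,(1+|t|)^l\,\hbar^{k_m},\qquad k_0=1,\quad k_1=2,\quad k_m=\lfloor (m+1)/2\rfloor\ \ (m\ge 2).$$ -/

import Mathlib

open MeasureTheory

noncomputable section

namespace NormalFormPropagation

/-- The Hilbert space `L²(ℝ; ℂ)`. -/
abbrev L2 : Type := Lp ℂ 2 (volume : Measure ℝ)

/-! ### Weyl quantization -/

/-- The semiclassical Weyl quantization of the symbol `a(x, ξ)`:
`(Op_ħ^w(a) u)(x) = (2πħ)⁻¹ ∫ (∫ e^{i(x-y)ξ/ħ} a((x+y)/2, ξ) u(y) dy) dξ`.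
For a polynomial symbol and a Schwartz function `u`, the integral in `y` and then the integral in
`ξ` converge absolutely. -/
def weylOp (ħ : ℝ) (a : ℝ → ℝ → ℂ) (u : ℝ → ℂ) (x : ℝ) : ℂ :=
  (1 / (2 * Real.pi * ħ) : ℂ) *
    ∫ ξ : ℝ, ∫ y : ℝ,
      Complex.exp (Complex.I * ((x - y) * ξ / ħ : ℝ)) * a ((x + y) / 2) ξ * u y

/-- The graph in `L² × L²` of the operator `Op_ħ^w(a)` with domain the Schwartz space. -/
def weylGraph (ħ : ℝ) (a : ℝ → ℝ → ℂ) : Set (L2 × L2) :=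
  {p | ∃ u : SchwartzMap ℝ ℂ,
    (p.1 : ℝ → ℂ) =ᵐ[volume] (u : ℝ → ℂ) ∧ (p.2 : ℝ → ℂ) =ᵐ[volume] weylOp ħ a (u : ℝ → ℂ)}

/-! ### The unitary group `e^{-itA/ħ}` -/

/-- `U` is the strongly continuous unitary group `t ↦ e^{-itA/ħ}`, where `A` is the closure of
`Op_ħ^w(a)` on the Schwartz space: the infinitesimal generator of `U` is exactly `-(i/ħ) A`. -/
structure IsSchrodingerGroup (ħ : ℝ) (a : ℝ → ℝ → ℂ) (U : ℝ → L2 ≃ₗᵢ[ℂ] L2) : Prop where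
  map_zero : ∀ f : L2, U 0 f = f
  map_add : ∀ (s t : ℝ) (f : L2), U (s + t) f = U s (U t f)
  continuous : ∀ f : L2, Continuous fun t : ℝ => U t f
  generator : ∀ f g : L2, (f, g) ∈ closure (weylGraph ħ a) ↔
    HasDerivAt (fun t : ℝ => U t f) (-(Complex.I / (ħ : ℂ)) • g) 0

open Classical in
/-- The unitary group `t ↦ e^{-itA/ħ}` generated by the closure `A` of `Op_ħ^w(a)` on the Schwartz
space (a group with a given generator is unique; the value is the identity if there is none). -/
def schrodingerGroup (ħ : ℝ) (a : ℝ → ℝ → ℂ) : ℝ → L2 ≃ₗᵢ[ℂ] L2 :=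
  if h : ∃ U, IsSchrodingerGroup ħ a U then h.choose
  else fun _ => LinearIsometryEquiv.refl ℂ L2

/-! ### The normal form symbol -/

/-- The coefficient `q^α(ħ) = ∑_{i=0}^N ħ^i q_i^α`. -/
def coeffQ (N : ℕ) (q : ℕ → ℕ → ℝ) (ħ : ℝ) (α : ℕ) : ℝ :=
  ∑ i ∈ Finset.range (N + 1), ħ ^ i * q α i

/-- The normal form symbol `q^(N)(x, ξ; ħ) = ∑_{α=1}^N q^α(ħ) (xξ)^α`. -/
def symbolQ (N : ℕ) (q : ℕ → ℕ → ℝ) (ħ : ℝ) (x ξ : ℝ) : ℂ :=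
  ((∑ α ∈ Finset.Icc 1 N, coeffQ N q ħ α * (x * ξ) ^ α : ℝ) : ℂ)

/-! ### Coherent states, excited states, squeezed states -/

/-- The Gaussian `φ₀(x) = (πħ)^{-1/4} e^{-x²/(2ħ)}`. -/
def groundState (ħ : ℝ) (x : ℝ) : ℂ :=
  (((Real.pi * ħ) ^ (-(1 / 4) : ℝ) * Real.exp (-x ^ 2 / (2 * ħ)) : ℝ) : ℂ)

/-- The raising operator `a* = Op_ħ((x - iξ)/√(2ħ)) = (x - ħ ∂ₓ)/√(2ħ)`. -/
def raising (ħ : ℝ) (f : ℝ → ℂ) (x : ℝ) : ℂ :=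
  ((x : ℂ) * f x - (ħ : ℂ) * deriv f x) / (Real.sqrt (2 * ħ) : ℂ)

/-- The normalized excited state `φ_m = (m!)^{-1/2} (a*)^m φ₀`. -/
def excitedState (ħ : ℝ) (m : ℕ) (x : ℝ) : ℂ :=
  (raising ħ)^[m] (groundState ħ) x / (Real.sqrt (m.factorial : ℝ) : ℂ)

/-- The unitary dilation `(D_β u)(x) = e^{-β/2} u(e^{-β} x)`. -/
def dilation (β : ℝ) (u : ℝ → ℂ) (x : ℝ) : ℂ :=
  (Real.exp (-β / 2) : ℂ) * u (Real.exp (-β) * x)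

theorem memLp_groundState {ħ : ℝ} (hħ : 0 < ħ) :
    MemLp (groundState ħ) 2 (volume : Measure ℝ) := by
  have hc : Continuous (groundState ħ) := by
    unfold groundState
    fun_prop
  rw [memLp_two_iff_integrable_sq_norm hc.aestronglyMeasurable]
  have h := (integrable_exp_neg_mul_sq (b := 1 / ħ) (by positivity)).const_mul
    (((Real.pi * ħ) ^ (-(1 / 4) : ℝ)) ^ 2)
  refine h.congr (Filter.Eventually.of_forall fun x => ?_)
  simp only [groundState, Complex.norm_real, Real.norm_eq_abs, sq_abs, mul_pow, ← Real.exp_nat_mul]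
  congr 2
  field_simp
  push_cast
  ring

/-- The Gaussian `φ₀` as an element of `L²(ℝ)`. -/
def groundL2 (ħ : ℝ) (hħ : 0 < ħ) : L2 := (memLp_groundState hħ).toLp (groundState ħ)

/-! ### Coefficients of the expansion -/

/-- The value `c(t, ħ)` of a polynomial in `(t, ħ)`; the outer variable is `t`, the inner one is
`ħ`, so that `natDegree` is the degree in `t`. -/
def evalTH (c : Polynomial (Polynomial ℂ)) (t ħ : ℝ) : ℂ :=
  c.evalEval (ħ : ℂ) (t : ℂ)

/-- The order in `ħ` of the coefficient of `φ_{2m}`: `1` for `m = 0`, `2` for `m = 1`, and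
`⌊(m+1)/2⌋` for `m ≥ 2`. -/
def hbarOrder (m : ℕ) : ℕ :=
  if m = 0 then 1 else if m = 1 then 2 else (m + 1) / 2

/-- The error `e^{-itQ/ħ} φ₀ - D_{tq¹} φ₀ - ∑_{m=0}^{M} c_m(t,ħ) D_{tq¹} φ_{2m}` where
`Q = Op_ħ^w(q^(N))` and `q¹ = q¹(ħ)`. -/
def expansionError (N : ℕ) (q : ℕ → ℕ → ℝ) (c : ℕ → Polynomial (Polynomial ℂ)) (M : ℕ)
    (ħ : ℝ) (hħ : 0 < ħ) (t : ℝ) (x : ℝ) : ℂ :=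
  (schrodingerGroup ħ (symbolQ N q ħ) t (groundL2 ħ hħ) : ℝ → ℂ) x
    - dilation (t * coeffQ N q ħ 1) (groundState ħ) x
    - ∑ m ∈ Finset.range (M + 1),
        evalTH (c m) t ħ * dilation (t * coeffQ N q ħ 1) (excitedState ħ (2 * m)) x

end NormalFormPropagation

end

/-! ### Stone's theorem: bounded skew generators and resolvents of a skew graph -/

section Stone

open Filter Topology NormedSpace

variable {H : Type*} [NormedAddCommGroup H] [InnerProductSpace ℂ H] [CompleteSpace H]

/-! Everything reduces to functions of one operator, the dilation generator `D = -i(x∂ + 1/2)`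
(`dilGen`). The Weyl quantization of `(xξ)^α` is `ħ^α p_α(D)` with `p_α` (`weylPoly`) real of degree
at most `α`, so `Q = ħ P(D)` with `P = q¹ X + ρ`, where `ρ` collects `α ≥ 2` and has coefficients
`O(ħ)` (`weylOp_symbolQ_eq`, `exists_coeff_polyQ_bound`).

Existence of the group. A closed skew graph whose shifts by nonzero reals have dense range generates
a unitary group (`exists_unitaryGroup`). For `-iP(D)` the shift is a polynomial in `x∂ + 1/2`
without roots on the imaginary axis. A vector orthogonal to the range of a factor `x∂ + 1/2 - a` has
matrix elements `e^{-aβ}k(0)` along the dilations; these are bounded in `β`, hence zero when `Re a ≠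
0` (`dense_range_aeval_eulerOp`).

Expansion. The factor `e^{-itq¹D}` is the dilation of parameter `tq¹`, and it commutes with `ρ(D)`.
Only `e^{-itρ(D)}` is Taylor expanded in `t`, to order `l`; Duhamel's formula bounds the error by
`|t|^{l+1} ‖ρ(D)^{l+1}φ₀‖ = O((|t|ħ)^{l+1})` (`norm_schrodingerGroup_sub_taylorState_le`). All norms
are independent of `ħ`, because `φ_m` is a dilation of its version at `ħ = 1` and `D` commutes with
dilations.

Coefficients. With ladder operators, `x∂ + 1/2 = (a² - (a*)²)/2`, so `D^s φ₀` lies in the span of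
`φ_{2m}`, `m ≤ s`. The coefficient of `D^s` in `ρ(D)^j` is `O(ħ^{max(j, s-j)})`, so `φ_{2m}` occurs
at order `t^j` with size `O(ħ^{max(j, m-j)})`. This gives the orders `⌊(m+1)/2⌋`, and `ħ^{l+1}` for
the terms with `m > 2l`. The better order `2` at `m = 1` holds because `p_2` has no linear term and
`D²φ₀` has no `φ_2` component. -/

theorem hasDerivAt_exp_smul_apply (B : H →L[ℂ] H) (f : H) (t : ℝ) :
    HasDerivAt (fun s : ℝ => exp (s • B) f) (exp (t • B) (B f)) t := by
  have h := hasDerivAt_exp_smul_const (𝕂 := ℝ) B t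
  exact (((ContinuousLinearMap.apply ℂ H f).restrictScalars ℝ).hasFDerivAt.comp_hasDerivAt t h)

theorem norm_exp_smul_skew {B : H →L[ℂ] H} (hB : ∀ f g, inner ℂ f (B g) + inner ℂ (B f) g = 0)
    (t : ℝ) (f : H) : ‖exp (t • B) f‖ = ‖f‖ := by
  have hd : ∀ s : ℝ, HasDerivAt (fun s : ℝ => exp (s • B) f) (B (exp (s • B) f)) s := fun s =>
    ((ContinuousLinearMap.apply ℂ H f).restrictScalars ℝ).hasFDerivAt.comp_hasDerivAt s
      (hasDerivAt_exp_smul_const' (𝕂 := ℝ) B s)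
  have hi : ∀ s : ℝ, HasDerivAt (fun s : ℝ => inner ℂ (exp (s • B) f) (exp (s • B) f)) 0 s :=
    fun s => by
      have h := (hd s).inner ℂ (hd s)
      rwa [hB] at h
  have h := is_const_of_deriv_eq_zero (fun s => (hi s).differentiableAt) (fun s => (hi s).deriv) t 0
  simp only [zero_smul, NormedSpace.exp_zero, one_apply_eq_self] at h
  rw [@norm_eq_sqrt_re_inner ℂ, h, ← @norm_eq_sqrt_re_inner ℂ]

theorem norm_exp_smul_sub_le {B : H →L[ℂ] H} (hB : ∀ f g, inner ℂ f (B g) + inner ℂ (B f) g = 0) (f : H) (t : ℝ) :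
    ‖exp (t • B) f - f‖ ≤ ‖B f‖ * |t| := by
  have h := convex_univ.norm_image_sub_le_of_norm_hasDerivWithin_le (𝕜 := ℝ)
    (fun s _ => (hasDerivAt_exp_smul_apply B f s).hasDerivWithinAt)
    (fun s _ => (norm_exp_smul_skew hB s (B f)).le) (Set.mem_univ 0) (Set.mem_univ t)
  simpa using h

/-- Commuting exponentials factor as `e^{tB} = e^{tB'} e^{t(B - B')}`, and `B - B'` is again skew.
No operator norm enters, so the bound serves approximations of an unbounded generator. -/
theorem norm_exp_smul_sub_exp_smul_le {B B' : H →L[ℂ] H} (hB : ∀ f g, inner ℂ f (B g) + inner ℂ (B f) g = 0)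
    (hB' : ∀ f g, inner ℂ f (B' g) + inner ℂ (B' f) g = 0) (hc : Commute B B') (f : H) (t : ℝ) :
    ‖exp (t • B) f - exp (t • B') f‖ ≤ ‖B f - B' f‖ * |t| := by
  let +nondep : NormedAlgebra ℚ (H →L[ℂ] H) := .restrictScalars ℚ ℂ _
  have hc' : Commute (t • B') (t • (B - B')) :=
    ((hc.symm.sub_right (Commute.refl B')).smul_left t).smul_right t
  have h1 : exp (t • B) = exp (t • B') * exp (t • (B - B')) := by
    rw [← exp_add_of_commute hc', ← smul_add]
    congr 2
    abel
  rw [h1, mul_apply_eq_comp, ← map_sub, norm_exp_smul_skew hB']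
  refine norm_exp_smul_sub_le (fun f g => ?_) f t
  have h2 := hB f g
  have h3 := hB' f g
  simp only [sub_apply, inner_sub_left, inner_sub_right]
  linear_combination h2 - h3

/-- A first-order Taylor estimate that survives a limit in `B` with `‖B‖` unbounded: `g` stands for
the limit of `B f`, and `g'` is a vector near `g` on which `B` stays bounded. -/
theorem norm_exp_smul_sub_sub_smul_le {B : H →L[ℂ] H} (hB : ∀ f g, inner ℂ f (B g) + inner ℂ (B f) g = 0)
    (f g g' : H) (t : ℝ) :
    ‖exp (t • B) f - f - t • g‖ ≤ (‖B f - g‖ + 2 * ‖g - g'‖ + ‖B g'‖ * |t|) * |t| := by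
  have hd : ∀ s : ℝ, HasDerivAt (fun s : ℝ => exp (s • B) f - s • g)
      (exp (s • B) (B f) - g) s := fun s => by
    have := (hasDerivAt_exp_smul_apply B f s).sub ((hasDerivAt_id s).smul_const g)
    rw [one_smul] at this
    exact this
  have hb : ∀ s ∈ Set.Icc (-|t|) |t|, ‖exp (s • B) (B f) - g‖ ≤
      ‖B f - g‖ + 2 * ‖g - g'‖ + ‖B g'‖ * |t| := fun s hs => by
    have h1 : exp (s • B) (B f) - g = exp (s • B) (B f - g) + exp (s • B) (g - g')
        + (exp (s • B) g' - g') - (g - g') := by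
      simp only [map_sub]; abel
    have h2 := norm_exp_smul_sub_le hB g' s
    have h3 : ‖B g'‖ * |s| ≤ ‖B g'‖ * |t| :=
      mul_le_mul_of_nonneg_left (abs_le.2 hs) (norm_nonneg _)
    rw [h1]
    refine (norm_sub_le _ _).trans ?_
    have h4 := norm_add₃_le (a := exp (s • B) (B f - g)) (b := exp (s • B) (g - g'))
      (c := exp (s • B) g' - g')
    rw [norm_exp_smul_skew hB, norm_exp_smul_skew hB] at h4
    linarith
  have h := (convex_Icc (-|t|) |t|).norm_image_sub_le_of_norm_hasDerivWithin_le (𝕜 := ℝ)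
    (fun s _ => (hd s).hasDerivWithinAt) hb (x := 0) (y := t) (by simp)
    ⟨neg_abs_le t, le_abs_self t⟩
  have e : exp (t • B) f - f - t • g = exp (t • B) f - t • g - (exp ((0 : ℝ) • B) f - (0 : ℝ) • g) := by
    simp; abel
  rw [e]
  simpa using h

variable {Γ : Submodule ℂ (H × H)}

/-- Skewness makes the cross term vanish: `‖n f - g‖² = n²‖f‖² + ‖g‖²` on the graph. The shift is
therefore bounded below, its range is closed, and density makes it bijective; `R` is the first
component of its inverse. -/
theorem exists_resolvent (hcl : IsClosed (Γ : Set (H × H)))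
    (hskew : ∀ p ∈ Γ, ∀ q ∈ Γ, inner ℂ p.1 q.2 + inner ℂ p.2 q.1 = 0) {n : ℝ} (hn : n ≠ 0)
    (hdense : Dense {h : H | ∃ p ∈ Γ, n • p.1 - p.2 = h}) :
    ∃ R : H →L[ℂ] H, (∀ h, (R h, n • R h - h) ∈ Γ) ∧ (∀ p ∈ Γ, R (n • p.1 - p.2) = p.1) ∧
      ∀ h, |n| * ‖R h‖ ≤ ‖h‖ := by
  have hnorm : ∀ p ∈ Γ, ‖n • p.1 - p.2‖ ^ 2 = n ^ 2 * ‖p.1‖ ^ 2 + ‖p.2‖ ^ 2 := fun p hp => by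
    have h0 : RCLike.re (inner ℂ p.1 p.2) = (0 : ℝ) := by
      have h1 := congrArg RCLike.re (hskew p hp p hp)
      rw [map_add, ← inner_conj_symm p.2 p.1, RCLike.conj_re] at h1
      simp only [map_zero] at h1
      linarith
    rw [← Complex.coe_smul, @norm_sub_sq ℂ, inner_smul_left, norm_smul, mul_pow]
    simp only [Complex.conj_ofReal, Complex.norm_real, Real.norm_eq_abs, sq_abs]
    have : RCLike.re ((n : ℂ) * inner ℂ p.1 p.2) = n * RCLike.re (inner ℂ p.1 p.2) := by
      simp
    rw [this, h0]
    ring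
  have hle1 : ∀ p ∈ Γ, |n| * ‖p.1‖ ≤ ‖n • p.1 - p.2‖ := fun p hp => by
    refine le_of_sq_le_sq ?_ (norm_nonneg _)
    rw [hnorm p hp, mul_pow, sq_abs]
    nlinarith [sq_nonneg ‖p.2‖]
  have hle2 : ∀ p ∈ Γ, ‖p.2‖ ≤ ‖n • p.1 - p.2‖ := fun p hp => by
    refine le_of_sq_le_sq ?_ (norm_nonneg _)
    rw [hnorm p hp]
    nlinarith [mul_nonneg (sq_nonneg n) (sq_nonneg ‖p.1‖)]
  let F : Γ →ₗ[ℂ] H :=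
    ((n : ℂ) • LinearMap.fst ℂ H H - LinearMap.snd ℂ H H).comp Γ.subtype
  have hF : ∀ p : Γ, F p = n • (p : H × H).1 - (p : H × H).2 := fun p => by
    simp [F]
  have hFc : Continuous F := by
    have : (F : Γ → H) = fun p : Γ => n • (p : H × H).1 - (p : H × H).2 := funext hF
    rw [this]
    fun_prop
  have hanti : AntilipschitzWith (Real.toNNReal (1 + |n|⁻¹)) F := by
    refine AddMonoidHomClass.antilipschitz_of_bound F fun p => ?_
    rw [Real.coe_toNNReal _ (by positivity), hF]
    have h1 := hle1 p p.2
    have h2 := hle2 p p.2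
    have hpos : 0 < |n| := abs_pos.2 hn
    have h3 : ‖(p : H × H).1‖ ≤ |n|⁻¹ * ‖n • (p : H × H).1 - (p : H × H).2‖ := by
      rw [inv_mul_eq_div, le_div_iff₀ hpos]
      linarith
    have h4 : 0 ≤ |n|⁻¹ * ‖n • (p : H × H).1 - (p : H × H).2‖ := by positivity
    rw [Submodule.coe_norm, Prod.norm_def]
    refine max_le ?_ ?_ <;> nlinarith [norm_nonneg (n • (p : H × H).1 - (p : H × H).2)]
  have : CompleteSpace Γ := hcl.completeSpace_coe
  have hclosed : IsClosed (Set.range F) :=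
    hanti.isClosed_range (F.toAddMonoidHom.uniformContinuous_of_continuousAt_zero ?_)
  swap
  · exact hFc.continuousAt
  have hrange : Set.range F = Set.univ := by
    rw [← hclosed.closure_eq]
    refine Dense.closure_eq (hdense.mono ?_)
    rintro _ ⟨p, hp, rfl⟩
    exact ⟨⟨p, hp⟩, hF ⟨p, hp⟩⟩
  let e : Γ ≃ₗ[ℂ] H := LinearEquiv.ofBijective F ⟨hanti.injective, Set.range_eq_univ.1 hrange⟩
  have he : ∀ p, e p = n • (p : H × H).1 - (p : H × H).2 := hF
  have hbound : ∀ h, |n| * ‖((e.symm h : Γ) : H × H).1‖ ≤ ‖h‖ := fun h => by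
    have := hle1 _ (e.symm h).2
    rwa [← he, e.apply_symm_apply] at this
  refine ⟨LinearMap.mkContinuous ((LinearMap.fst ℂ H H).comp (Γ.subtype.comp e.symm.toLinearMap))
    |n|⁻¹ fun h => ?_, fun h => ?_, fun p hp => ?_, fun h => ?_⟩
  · rw [inv_mul_eq_div, le_div_iff₀ (abs_pos.2 hn), mul_comm]
    exact hbound h
  · have h1 : n • ((e.symm h : Γ) : H × H).1 - h = ((e.symm h : Γ) : H × H).2 := by
      have := he (e.symm h)
      rw [e.apply_symm_apply] at this
      rw [sub_eq_iff_eq_add, add_comm, ← sub_eq_iff_eq_add]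
      exact this.symm
    change (((e.symm h : Γ) : H × H).1, n • ((e.symm h : Γ) : H × H).1 - h) ∈ Γ
    rw [h1]
    exact (e.symm h).2
  · change ((e.symm _ : Γ) : H × H).1 = _
    rw [← he ⟨p, hp⟩, e.symm_apply_apply]
  · exact hbound h

end Stone

/-! ### Stone's theorem: construction of the unitary group -/

section Stone

open Filter Topology NormedSpace

variable {H : Type*} [NormedAddCommGroup H] [InnerProductSpace ℂ H] [CompleteSpace H]

variable {Γ : Submodule ℂ (H × H)}

/-- A symmetrized Yosida approximation. With `R(λ) = (λ - A)⁻¹`, the operator `G = (a²/2)(R(a) +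
R(-a))` is formally `a²A(a² - A²)⁻¹`. It is skew since the adjoint of `R(a)` is `-R(-a)`, and the
resolvent identity makes these operators commute. -/
theorem exists_skew_approximation (hcl : IsClosed (Γ : Set (H × H)))
    (hskew : ∀ p ∈ Γ, ∀ q ∈ Γ, inner ℂ p.1 q.2 + inner ℂ p.2 q.1 = 0)
    (hdom : Dense {f : H | ∃ g, (f, g) ∈ Γ})
    (hrange : ∀ n : ℝ, n ≠ 0 → Dense {h : H | ∃ p ∈ Γ, n • p.1 - p.2 = h}) :
    ∃ G : ℕ → H →L[ℂ] H, (∀ n f g, inner ℂ f (G n g) + inner ℂ (G n f) g = 0) ∧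
      (∀ n m, Commute (G n) (G m)) ∧
      ∀ p ∈ Γ, Tendsto (fun n => G n p.1) atTop (𝓝 p.2) := by
  choose! R hR1 hR2 hR3 using fun (n : ℝ) (hn : n ≠ 0) => exists_resolvent hcl hskew hn (hrange n hn)
  have hadj : ∀ n : ℝ, n ≠ 0 → ∀ h k, inner ℂ (R n h) k = -inner ℂ h (R (-n) k) := fun n hn h k => by
    have h1 := hskew _ (hR1 n hn h) _ (hR1 (-n) (neg_ne_zero.2 hn) k)
    simp only [inner_sub_left, inner_sub_right, ← Complex.coe_smul, inner_smul_left,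
      inner_smul_right, Complex.conj_ofReal, Complex.ofReal_neg] at h1
    linear_combination -h1
  have hres : ∀ n m : ℝ, n ≠ 0 → m ≠ 0 → ∀ h, R n h - R m h = (m - n) • R n (R m h) :=
    fun n m hn hm h => by
      have h1 := hR2 n hn _ (Γ.sub_mem (hR1 n hn h) (hR1 m hm h))
      simp only [Prod.fst_sub, Prod.snd_sub] at h1
      rw [← h1, ← (R n).map_smul_of_tower (m - n)]
      congr 1
      module
  have hcomm : ∀ n m : ℝ, n ≠ 0 → m ≠ 0 → Commute (R n) (R m) := fun n m hn hm => by
    rcases eq_or_ne n m with rfl | hnm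
    · exact Commute.refl _
    · ext h
      have h1 := hres n m hn hm h
      have h2 := hres m n hm hn h
      have h3 : (m - n) • (R n (R m h) - R m (R n h)) = 0 := by
        rw [smul_sub, ← h1, show m - n = -(n - m) by ring, neg_smul, ← h2]
        abel
      exact sub_eq_zero.1 ((smul_eq_zero.1 h3).resolve_left (sub_ne_zero.2 hnm.symm))
  have hbd : ∀ n : ℝ, n ≠ 0 → ∀ h, ‖n • R n h‖ ≤ ‖h‖ := fun n hn h => by
    rw [norm_smul, Real.norm_eq_abs]
    exact hR3 n hn h
  let a : ℕ → ℝ := fun n => n + 1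
  have ha : ∀ n, a n ≠ 0 := fun n => by positivity
  have ha' : ∀ n, -a n ≠ 0 := fun n => neg_ne_zero.2 (ha n)
  have hatop : Tendsto (fun n => (a n)⁻¹) atTop (𝓝 0) :=
    tendsto_inv_atTop_zero.comp (tendsto_atTop_add_const_right _ _ tendsto_natCast_atTop_atTop)
  -- On the domain `b R(b) f - f = R(b) A f = O(1/|b|)`; density and `‖b R(b)‖ ≤ 1` extend the
  -- convergence to all vectors.
  have happrox : ∀ b : ℕ → ℝ, (∀ n, b n ≠ 0) → (∀ n, |b n| = a n) →
      ∀ h, Tendsto (fun n => b n • R (b n) h) atTop (𝓝 h) := fun b hb hba h => by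
    rw [Metric.tendsto_atTop]
    intro ε hε
    obtain ⟨f, hf, g, hfg⟩ := Metric.dense_iff.1 hdom h (ε / 3) (by positivity)
    rw [Metric.mem_ball, dist_eq_norm] at hf
    have h1 : Tendsto (fun n => (a n)⁻¹ * ‖g‖) atTop (𝓝 0) := by
      simpa using hatop.mul_const ‖g‖
    obtain ⟨N, hN⟩ := (h1.eventually (gt_mem_nhds (show (0 : ℝ) < ε / 3 by positivity))).exists_forall_of_atTop
    refine ⟨N, fun n hn => ?_⟩
    have h2 : b n • R (b n) f - f = R (b n) g := by
      have := hR2 (b n) (hb n) _ hfg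
      rw [map_sub, ← Complex.coe_smul, map_smul, Complex.coe_smul] at this
      rw [sub_eq_iff_eq_add, add_comm, ← sub_eq_iff_eq_add]
      exact this
    have h3 : ‖R (b n) g‖ ≤ (a n)⁻¹ * ‖g‖ := by
      have := hR3 (b n) (hb n) g
      have hpos : 0 < a n := by positivity
      rw [hba] at this
      rw [inv_mul_eq_div, le_div_iff₀ hpos]
      linarith
    have h4 : b n • R (b n) h - h = R (b n) g + (f - h) - b n • R (b n) (f - h) := by
      rw [← h2]
      simp only [map_sub, smul_sub]
      abel
    have h5 := hbd (b n) (hb n) (f - h)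
    have h6 := hN n hn
    rw [dist_eq_norm, h4]
    have h7 := norm_sub_le (R (b n) g + (f - h)) (b n • R (b n) (f - h))
    have h8 := norm_add_le (R (b n) g) (f - h)
    linarith
  refine ⟨fun n => (a n ^ 2 / 2 : ℝ) • (R (a n) + R (-a n)), fun n f g => ?_, fun n m => ?_,
    fun p hp => ?_⟩
  · simp only [smul_apply, add_apply, ← Complex.coe_smul,
      inner_smul_left, inner_smul_right, inner_add_left, inner_add_right, Complex.conj_ofReal]
    rw [hadj _ (ha n), hadj _ (ha' n), neg_neg]
    ring
  · refine ((Commute.add_left ?_ ?_).smul_left _).smul_right _ <;> refine Commute.add_right ?_ ?_ <;>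
      apply hcomm <;> first | exact ha _ | exact ha' _
  · have h1 := happrox a ha (fun n => abs_of_pos (by positivity)) p.2
    have h2 := happrox (fun n => -a n) ha'
      (fun n => by rw [abs_neg]; exact abs_of_pos (by positivity)) p.2
    -- On the domain `G f` is the mean of `a R(a) A f` and `-a R(-a) A f`, each of which tends to `A
    -- f`; the terms `∓a f` cancel.
    have h3 := (h1.add h2).const_smul (2⁻¹ : ℝ)
    have h4 : (2⁻¹ : ℝ) • (p.2 + p.2) = p.2 := by module
    rw [h4] at h3
    refine h3.congr fun n => ?_
    have h5 := hR2 _ (ha n) _ hp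
    have h6 := hR2 _ (ha' n) _ hp
    simp only [map_sub, ← Complex.coe_smul, map_smul] at h5 h6
    simp only [Complex.coe_smul] at h5 h6
    have h7 : R (a n) p.2 = a n • R (a n) p.1 - p.1 := eq_sub_of_add_eq (by
      rw [add_comm]; exact (sub_eq_iff_eq_add.1 h5).symm)
    have h8 : R (-a n) p.2 = -a n • R (-a n) p.1 - p.1 := eq_sub_of_add_eq (by
      rw [add_comm]; exact (sub_eq_iff_eq_add.1 h6).symm)
    rw [h7, h8]
    simp only [smul_apply, add_apply]
    module

/-- The exponentials of the skew approximations are Cauchy on the domain, as they commute, and then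
everywhere, as they are isometries. Their limit is the group. -/
theorem exists_unitaryGroup (hcl : IsClosed (Γ : Set (H × H)))
    (hskew : ∀ p ∈ Γ, ∀ q ∈ Γ, inner ℂ p.1 q.2 + inner ℂ p.2 q.1 = 0)
    (hdom : Dense {f : H | ∃ g, (f, g) ∈ Γ})
    (hrange : ∀ n : ℝ, n ≠ 0 → Dense {h : H | ∃ p ∈ Γ, n • p.1 - p.2 = h}) :
    ∃ U : ℝ → H ≃ₗᵢ[ℂ] H, (∀ f, U 0 f = f) ∧ (∀ s t f, U (s + t) f = U s (U t f)) ∧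
      (∀ f, Continuous fun t => U t f) ∧
      ∀ f g, (f, g) ∈ Γ ↔ HasDerivAt (fun t => U t f) g 0 := by
  obtain ⟨G, hG, hGc, hGlim⟩ := exists_skew_approximation hcl hskew hdom hrange
  let E : ℕ → ℝ → H →L[ℂ] H := fun n t => exp (t • G n)
  have hE : ∀ n t f, ‖E n t f‖ = ‖f‖ := fun n t f => norm_exp_smul_skew (hG n) t f
  have hconv : ∀ t f, ∃ u, Tendsto (fun n => E n t f) atTop (𝓝 u) := fun t f => by
    refine cauchySeq_tendsto_of_complete (Metric.cauchySeq_iff'.2 fun ε hε => ?_)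
    obtain ⟨f', hf, g, hfg⟩ := Metric.dense_iff.1 hdom f (ε / 4) (by positivity)
    rw [Metric.mem_ball, dist_comm, dist_eq_norm] at hf
    have hc := Metric.cauchySeq_iff'.1 (hGlim _ hfg).cauchySeq (ε / (4 * (|t| + 1))) (by positivity)
    obtain ⟨N, hN⟩ := hc
    refine ⟨N, fun n hn => ?_⟩
    have h1 := norm_exp_smul_sub_exp_smul_le (hG n) (hG N) (hGc n N) f' t
    have h2 : ‖G n f' - G N f'‖ * |t| ≤ ε / 4 := by
      have := (hN n hn).le
      rw [dist_eq_norm, le_div_iff₀ (by positivity)] at this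
      nlinarith [abs_nonneg t, norm_nonneg (G n f' - G N f')]
    have h3 : E n t f - E N t f = E n t (f - f') + (E n t f' - E N t f') - E N t (f - f') := by
      simp only [map_sub]; abel
    rw [dist_eq_norm, h3]
    have h4 := norm_sub_le (E n t (f - f') + (E n t f' - E N t f')) (E N t (f - f'))
    have h5 := norm_add_le (E n t (f - f')) (E n t f' - E N t f')
    rw [hE] at h4 h5
    have h6 : ‖E n t f' - E N t f'‖ ≤ ‖G n f' - G N f'‖ * |t| := h1
    linarith
  choose u hu using hconv
  have hnorm : ∀ t f, ‖u t f‖ = ‖f‖ := fun t f =>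
    tendsto_nhds_unique (hu t f).norm (by simp only [hE]; exact tendsto_const_nhds)
  have hadd : ∀ t f g, u t (f + g) = u t f + u t g := fun t f g =>
    tendsto_nhds_unique (hu t _) (by simpa only [map_add] using (hu t f).add (hu t g))
  have hsmul : ∀ t (c : ℂ) f, u t (c • f) = c • u t f := fun t c f =>
    tendsto_nhds_unique (hu t _) (by simpa only [map_smul] using (hu t f).const_smul c)
  have hsub : ∀ t f g, u t (f - g) = u t f - u t g := fun t f g => by
    rw [sub_eq_add_neg, hadd, ← neg_one_smul ℂ g, hsmul, neg_one_smul, sub_eq_add_neg]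
  have hgrp : ∀ s t f, u (s + t) f = u s (u t f) := fun s t f => by
    let +nondep : NormedAlgebra ℚ (H →L[ℂ] H) := .restrictScalars ℚ ℂ _
    refine tendsto_nhds_unique (hu _ f) ?_
    have h1 : ∀ n, E n (s + t) f = E n s (E n t f - u t f) + E n s (u t f) := fun n => by
      rw [← map_add, sub_add_cancel]
      simp only [E]
      rw [add_smul, exp_add_of_commute (((Commute.refl (G n)).smul_left s).smul_right t)]
      rfl
    simp only [h1]
    rw [← zero_add (u s (u t f))]
    refine Tendsto.add ?_ (hu s _)
    rw [tendsto_zero_iff_norm_tendsto_zero]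
    simp only [hE]
    simpa using ((hu t f).sub_const (u t f)).norm
  have hzero : ∀ f, u 0 f = f := fun f =>
    tendsto_nhds_unique (hu 0 f) (by simp [E])
  let U : ℝ → H ≃ₗᵢ[ℂ] H := fun t =>
    { toFun := u t
      map_add' := hadd t
      map_smul' := hsmul t
      invFun := u (-t)
      left_inv := fun f => by rw [← hgrp, neg_add_cancel, hzero]
      right_inv := fun f => by rw [← hgrp, add_neg_cancel, hzero]
      norm_map' := hnorm t }
  have hUu : ∀ t f, U t f = u t f := fun t f => rfl
  have hest : ∀ p ∈ Γ, ∀ q ∈ Γ, ∀ t, ‖u t p.1 - p.1 - t • p.2‖ ≤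
      (2 * ‖p.2 - q.1‖ + ‖q.2‖ * |t|) * |t| := fun p hp q hq t => by
    have h1 : Tendsto (fun n => (‖G n p.1 - p.2‖ + 2 * ‖p.2 - q.1‖ + ‖G n q.1‖ * |t|) * |t|) atTop
        (𝓝 ((‖p.2 - p.2‖ + 2 * ‖p.2 - q.1‖ + ‖q.2‖ * |t|) * |t|)) :=
      (((((hGlim p hp).sub_const _).norm.add_const _)).add
        ((hGlim q hq).norm.mul_const _)).mul_const _
    rw [sub_self, norm_zero, zero_add] at h1
    exact le_of_tendsto_of_tendsto' (((hu t p.1).sub_const _).sub_const _).norm h1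
      fun n => norm_exp_smul_sub_sub_smul_le (hG n) p.1 p.2 q.1 t
  have hderiv : ∀ p ∈ Γ, HasDerivAt (fun t => u t p.1) p.2 0 := fun p hp => by
    rw [hasDerivAt_iff_isLittleO_nhds_zero, Asymptotics.isLittleO_iff]
    intro ε hε
    obtain ⟨f', hf, g, hfg⟩ := Metric.dense_iff.1 hdom p.2 (ε / 4) (by positivity)
    rw [Metric.mem_ball, dist_comm, dist_eq_norm] at hf
    have h1 : Tendsto (fun t : ℝ => ‖g‖ * |t|) (𝓝 0) (𝓝 0) := by
      have : Continuous fun t : ℝ => ‖g‖ * |t| := by fun_prop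
      simpa using this.tendsto 0
    filter_upwards [h1.eventually (gt_mem_nhds (show (0 : ℝ) < ε / 2 by positivity))] with t ht
    rw [zero_add, hzero, Real.norm_eq_abs]
    refine (hest p hp _ hfg t).trans (mul_le_mul_of_nonneg_right ?_ (abs_nonneg t))
    simp only
    linarith
  have hcont0 : ∀ f, Tendsto (fun t => u t f) (𝓝 0) (𝓝 f) := fun f => by
    rw [Metric.tendsto_nhds]
    intro ε hε
    obtain ⟨f', hf, g, hfg⟩ := Metric.dense_iff.1 hdom f (ε / 4) (by positivity)
    rw [Metric.mem_ball, dist_comm, dist_eq_norm] at hf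
    have h1 := (hderiv _ hfg).continuousAt.tendsto
    rw [Metric.tendsto_nhds] at h1
    filter_upwards [h1 (ε / 4) (by positivity)] with t ht
    rw [hzero, dist_eq_norm] at ht
    have h2 : u t f - f = u t (f - f') + (u t f' - f') - (f - f') := by
      rw [hsub]; abel
    rw [dist_eq_norm, h2]
    have h4 := norm_sub_le (u t (f - f') + (u t f' - f')) (f - f')
    have h5 := norm_add_le (u t (f - f')) (u t f' - f')
    rw [hnorm] at h5
    linarith
  refine ⟨U, hzero, hgrp, fun f => ?_, fun f g => ⟨fun h => hderiv _ h, fun h => ?_⟩⟩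
  · refine continuous_iff_continuousAt.2 fun t => ?_
    have h1 : (fun s => U s f) = fun s => u t (u (s - t) f) := by
      funext s
      rw [hUu, ← hgrp, add_sub_cancel]
    have h2 : Tendsto (fun s : ℝ => s - t) (𝓝 t) (𝓝 0) := by
      have : Continuous fun s : ℝ => s - t := by fun_prop
      simpa using this.tendsto t
    rw [ContinuousAt, h1]
    exact ((U t).continuous.tendsto f).comp ((hcont0 f).comp h2)
  -- Maximality of the generator: if `U t f` has derivative `g` at `0`, the vector `k = f - R(f -
  -- g)` satisfies `(U t k)' = k` at `0`. As `‖U t k‖` is constant, `2‖k‖² = 0`, so `f = R(f - g)`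
  -- lies in the domain.
  · obtain ⟨R, hR1, -, -⟩ := exists_resolvent hcl hskew one_ne_zero (hrange 1 one_ne_zero)
    have h1 := hR1 (f - g)
    have h2 := h.sub (hderiv _ h1)
    set k := f - R (f - g) with hk
    have h3 : HasDerivAt (fun t => U t k) k 0 := by
      convert h2 using 1
      · funext t
        rw [hk, map_sub]
        rfl
      · simp only [one_smul, hk]
        abel
    have h4 := h3.inner ℂ h3
    have h5 : (fun t => inner ℂ (U t k) (U t k)) = fun _ => inner ℂ k k := by
      funext t
      exact (U t).inner_map_map k k
    rw [h5] at h4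
    have h6 := h4.unique (hasDerivAt_const _ _)
    have h7 : inner ℂ k k = 0 := by
      rw [hUu, hzero] at h6
      linear_combination h6 / 2
    have h8 : R (f - g) = f := (sub_eq_zero.1 (inner_self_eq_zero.1 h7)).symm
    rw [h8, one_smul, sub_sub_cancel] at h1
    exact h1

end Stone

noncomputable section

namespace NormalFormPropagation

open Filter Topology

/-! ### Operators on the Schwartz space -/

/-- The inclusion of the Schwartz space in `L²(ℝ)`. -/
abbrev schwartzToL2 : SchwartzMap ℝ ℂ →L[ℂ] L2 := SchwartzMap.toLpCLM ℂ ℂ 2 (volume : Measure ℝ)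

/-- Multiplication by the coordinate. -/
def mulX : Module.End ℂ (SchwartzMap ℝ ℂ) :=
  (SchwartzMap.smulLeftCLM ℂ (fun x : ℝ => (x : ℂ))).toLinearMap

/-- Differentiation. -/
def derivS : Module.End ℂ (SchwartzMap ℝ ℂ) := (SchwartzMap.derivCLM ℂ ℂ).toLinearMap

/-- The generator `x ∂ₓ + 1/2` of the dilations. -/
def eulerOp : Module.End ℂ (SchwartzMap ℝ ℂ) := mulX * derivS + (1 / 2 : ℂ) • 1

/-- The unitary dilation on the Schwartz space. -/
def dilS (β : ℝ) : Module.End ℂ (SchwartzMap ℝ ℂ) :=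
  (Real.exp (-β / 2) : ℂ) • (SchwartzMap.compCLMOfContinuousLinearEquiv ℂ
    (ContinuousLinearEquiv.unitsEquivAut ℝ (Units.mk0 (Real.exp (-β)) (Real.exp_ne_zero _)))).toLinearMap

theorem hasTemperateGrowth_ofReal : Function.HasTemperateGrowth (fun x : ℝ => (x : ℂ)) :=
  Complex.ofRealCLM.hasTemperateGrowth

@[simp]
theorem mulX_apply (u : SchwartzMap ℝ ℂ) (x : ℝ) : mulX u x = x * u x := by
  simp [mulX, SchwartzMap.smulLeftCLM_apply_apply hasTemperateGrowth_ofReal]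

@[simp]
theorem derivS_apply (u : SchwartzMap ℝ ℂ) (x : ℝ) : derivS u x = deriv u x := rfl

theorem hasDerivAt_schwartz (u : SchwartzMap ℝ ℂ) (x : ℝ) : HasDerivAt u (derivS u x) x :=
  u.hasDerivAt x

theorem eulerOp_apply (u : SchwartzMap ℝ ℂ) (x : ℝ) :
    eulerOp u x = x * derivS u x + u x / 2 := by
  simp [eulerOp]
  ring

theorem dilS_apply (β : ℝ) (u : SchwartzMap ℝ ℂ) (x : ℝ) :
    dilS β u x = (Real.exp (-β / 2) : ℂ) * u (Real.exp (-β) * x) := by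
  simp [dilS, mul_comm x]

theorem dilS_add (a b : ℝ) (u : SchwartzMap ℝ ℂ) : dilS (a + b) u = dilS a (dilS b u) := by
  ext x
  rw [dilS_apply, dilS_apply, dilS_apply, ← mul_assoc, ← mul_assoc, ← Complex.ofReal_mul,
    ← Real.exp_add, ← Real.exp_add]
  ring_nf

theorem dilS_zero (u : SchwartzMap ℝ ℂ) : dilS 0 u = u := by
  ext x
  simp [dilS_apply]

theorem derivS_dilS (β : ℝ) (u : SchwartzMap ℝ ℂ) (x : ℝ) :
    derivS (dilS β u) x = (Real.exp (-β) : ℂ) * dilS β (derivS u) x := by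
  have h1 : (dilS β u : ℝ → ℂ) = fun x => (Real.exp (-β / 2) : ℂ) * u (Real.exp (-β) * x) :=
    funext (dilS_apply β u)
  have h2 : HasDerivAt (fun x : ℝ => Real.exp (-β) * x) (Real.exp (-β)) x := by
    simpa using (hasDerivAt_id x).const_mul (Real.exp (-β))
  have h3 := ((hasDerivAt_schwartz u (Real.exp (-β) * x)).scomp x h2).const_mul
    (Real.exp (-β / 2) : ℂ)
  rw [derivS_apply, h1, dilS_apply]
  refine h3.deriv.trans ?_
  rw [Complex.real_smul]
  ring

theorem eulerOp_dilS (β : ℝ) (u : SchwartzMap ℝ ℂ) :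
    eulerOp (dilS β u) = dilS β (eulerOp u) := by
  ext x
  rw [eulerOp_apply, derivS_dilS, dilS_apply, dilS_apply, dilS_apply, eulerOp_apply]
  push_cast
  ring

theorem aeval_eulerOp_dilS (β : ℝ) (p : Polynomial ℂ) (u : SchwartzMap ℝ ℂ) :
    Polynomial.aeval eulerOp p (dilS β u) = dilS β (Polynomial.aeval eulerOp p u) := by
  have h : Commute eulerOp (dilS β) := LinearMap.ext fun u => eulerOp_dilS β u
  have h2 : Commute (Polynomial.aeval eulerOp p) (dilS β) := by
    induction p using Polynomial.induction_on' with
    | add p q hp hq => rw [map_add]; exact hp.add_left hq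
    | monomial n a =>
      rw [Polynomial.aeval_monomial]
      exact (Algebra.commute_algebraMap_left _ _).mul_left (h.pow_left n)
  exact LinearMap.congr_fun h2.eq u

theorem inner_dilS (β : ℝ) (u v : SchwartzMap ℝ ℂ) :
    inner ℂ (schwartzToL2 (dilS β u)) (schwartzToL2 (dilS β v)) =
      inner ℂ (schwartzToL2 u) (schwartzToL2 v) := by
  refine (SchwartzMap.inner_toL2_toL2_eq _ _ volume).trans
    (Eq.trans ?_ (SchwartzMap.inner_toL2_toL2_eq _ _ volume).symm)
  have h1 : ∀ x, inner ℂ (dilS β u x) (dilS β v x) =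
      (Real.exp (-β) : ℂ) * (fun y => inner ℂ (u y) (v y)) (Real.exp (-β) * x) := fun x => by
    rw [dilS_apply, dilS_apply]
    have h2 : (Real.exp (-β) : ℂ) = (Real.exp (-β / 2) : ℂ) * (Real.exp (-β / 2) : ℂ) := by
      rw [← Complex.ofReal_mul, ← Real.exp_add]
      ring_nf
    simp only [RCLike.inner_apply, map_mul, Complex.conj_ofReal]
    rw [h2]
    ring
  simp only [h1]
  rw [integral_const_mul, Measure.integral_comp_mul_left (fun y => inner ℂ (u y) (v y)),
    abs_of_pos (by positivity), Complex.real_smul, ← mul_assoc, ← Complex.ofReal_mul,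
    mul_inv_cancel₀ (Real.exp_ne_zero _), Complex.ofReal_one, one_mul]

theorem norm_dilS (β : ℝ) (u : SchwartzMap ℝ ℂ) :
    ‖schwartzToL2 (dilS β u)‖ = ‖schwartzToL2 u‖ := by
  rw [@norm_eq_sqrt_re_inner ℂ, inner_dilS, ← @norm_eq_sqrt_re_inner ℂ]

theorem memLp_inv_one_add_sq : MemLp (fun x : ℝ => (1 + x ^ 2)⁻¹) 2 (volume : Measure ℝ) := by
  have hc : Continuous fun x : ℝ => (1 + x ^ 2)⁻¹ :=
    (by fun_prop : Continuous fun x : ℝ => 1 + x ^ 2).inv₀ fun x => by positivity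
  rw [memLp_two_iff_integrable_sq_norm hc.aestronglyMeasurable]
  refine integrable_inv_one_add_sq.mono' (by fun_prop) (Eventually.of_forall fun x => ?_)
  have h1 : (1 + x ^ 2)⁻¹ ≤ 1 := inv_le_one_of_one_le₀ (by nlinarith [sq_nonneg x])
  have h2 : 0 ≤ (1 + x ^ 2)⁻¹ := by positivity
  rw [Real.norm_eq_abs, Real.norm_eq_abs, abs_of_nonneg h2, abs_of_nonneg (by positivity)]
  nlinarith

/-- An envelope in `L²` uniform for small `β`, used to turn pointwise Taylor bounds into `L²`
bounds. The factor `e³` is `e · e²`: `e` bounds the prefactor and `e²` bounds the ratio of `1 + x²`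
to `1 + (e^{-β}x)²`. -/
theorem exists_dilS_bound (u : SchwartzMap ℝ ℂ) :
    ∃ C, 0 ≤ C ∧ ∀ β x : ℝ, |β| ≤ 1 → ‖dilS β u x‖ ≤ C * (1 + x ^ 2)⁻¹ := by
  refine ⟨Real.exp 3 * (SchwartzMap.seminorm ℂ 0 0 u + SchwartzMap.seminorm ℂ 2 0 u), by positivity,
    fun β x hβ => ?_⟩
  obtain ⟨hβ1, hβ2⟩ := abs_le.1 hβ
  rw [dilS_apply, norm_mul, Complex.norm_real, Real.norm_eq_abs, abs_of_pos (Real.exp_pos _)]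
  set y := Real.exp (-β) * x with hy
  have h0 := u.norm_pow_mul_le_seminorm ℂ 0 y
  have h2 := u.norm_pow_mul_le_seminorm ℂ 2 y
  rw [pow_zero, one_mul] at h0
  rw [Real.norm_eq_abs, sq_abs] at h2
  have h3 : 1 + x ^ 2 ≤ Real.exp 2 * (1 + y ^ 2) := by
    have h4 : x ^ 2 = Real.exp (2 * β) * y ^ 2 := by
      rw [hy, mul_pow, ← Real.exp_nat_mul, ← mul_assoc, ← Real.exp_add]
      simp
    have h5 : Real.exp (2 * β) ≤ Real.exp 2 := Real.exp_le_exp.2 (by linarith)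
    have h6 : 1 ≤ Real.exp 2 := Real.one_le_exp (by norm_num)
    rw [h4]
    nlinarith [sq_nonneg y]
  have h7 : Real.exp (-β / 2) ≤ Real.exp 1 := Real.exp_le_exp.2 (by linarith)
  have h8 : Real.exp 3 = Real.exp 1 * Real.exp 2 := by rw [← Real.exp_add]; norm_num
  rw [← div_eq_mul_inv, le_div_iff₀ (by positivity), h8]
  have h9 : (1 + x ^ 2) * ‖u y‖ ≤ Real.exp 2 *
      (SchwartzMap.seminorm ℂ 0 0 u + SchwartzMap.seminorm ℂ 2 0 u) := by
    refine (mul_le_mul_of_nonneg_right h3 (norm_nonneg _)).trans ?_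
    rw [mul_assoc]
    refine mul_le_mul_of_nonneg_left ?_ (Real.exp_pos _).le
    linarith
  calc Real.exp (-β / 2) * ‖u y‖ * (1 + x ^ 2) = Real.exp (-β / 2) * ((1 + x ^ 2) * ‖u y‖) := by ring
    _ ≤ Real.exp 1 * (Real.exp 2 *
      (SchwartzMap.seminorm ℂ 0 0 u + SchwartzMap.seminorm ℂ 2 0 u)) :=
        mul_le_mul h7 h9 (by positivity) (Real.exp_pos _).le
    _ = _ := by ring

theorem hasDerivAt_dilS_apply (u : SchwartzMap ℝ ℂ) (β x : ℝ) :
    HasDerivAt (fun s => dilS s u x) (-dilS β (eulerOp u) x) β := by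
  have h1 : HasDerivAt (fun s : ℝ => Real.exp (-s) * x) (-Real.exp (-β) * x) β := by
    simpa using ((hasDerivAt_neg β).exp).mul_const x
  have h2 := (hasDerivAt_schwartz u (Real.exp (-β) * x)).scomp β h1
  have h3 : HasDerivAt (fun s : ℝ => Real.exp (-s / 2)) (Real.exp (-β / 2) * (-1 / 2)) β :=
    ((hasDerivAt_neg β).div_const 2).exp
  have h4 := h3.ofReal_comp.mul h2
  simp only [dilS_apply, eulerOp_apply]
  refine HasDerivAt.congr_deriv h4 ?_
  rw [Complex.real_smul]
  simp only [Function.comp]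
  push_cast
  ring

/-- Two applications of the mean value inequality in `β`, at fixed `x`, bound the first-order
remainder by `Cβ²/(1 + x²)`, which is `O(β²)` in `L²`. -/
theorem hasDerivAt_dilS_zero (u : SchwartzMap ℝ ℂ) :
    HasDerivAt (fun s => schwartzToL2 (dilS s u)) (-schwartzToL2 (eulerOp u)) 0 := by
  obtain ⟨C, hC0, hC⟩ := exists_dilS_bound (eulerOp (eulerOp u))
  have hpt : ∀ β x : ℝ, |β| ≤ 1 →
      ‖dilS β u x - u x + (β : ℂ) * eulerOp u x‖ ≤ C * |β| ^ 2 * (1 + x ^ 2)⁻¹ := fun β x hβ => by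
    set M := C * (1 + x ^ 2)⁻¹ with hM
    have hM0 : 0 ≤ M := by positivity
    have hcv : Convex ℝ (Set.Icc (-|β|) |β|) := convex_Icc _ _
    have h0 : (0 : ℝ) ∈ Set.Icc (-|β|) |β| := by simp
    have hsub : ∀ s ∈ Set.Icc (-|β|) |β|, |s| ≤ 1 := fun s hs => (abs_le.2 hs).trans hβ
    have h1 : ∀ s ∈ Set.Icc (-|β|) |β|, ‖eulerOp u x - dilS s (eulerOp u) x‖ ≤ M * |β| :=
      fun s hs => by
        have h2 := hcv.norm_image_sub_le_of_norm_hasDerivWithin_le (𝕜 := ℝ) (C := M)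
          (fun r _ => (hasDerivAt_dilS_apply (eulerOp u) r x).hasDerivWithinAt)
          (fun r hr => by rw [norm_neg]; exact hC r x (hsub r hr)) hs h0
        rw [dilS_zero, zero_sub, norm_neg, Real.norm_eq_abs] at h2
        have h5 : |s| ≤ |β| := abs_le.2 hs
        exact h2.trans (by gcongr)
    have hd : ∀ s : ℝ, HasDerivAt (fun s : ℝ => dilS s u x + (s : ℂ) * eulerOp u x)
        (eulerOp u x - dilS s (eulerOp u) x) s := fun s => by
      have h3 := (hasDerivAt_dilS_apply u s x).add
        ((hasDerivAt_id s).ofReal_comp.mul_const (eulerOp u x))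
      simp only [id, Complex.ofReal_one, one_mul] at h3
      rw [sub_eq_neg_add]
      exact h3
    have h4 := hcv.norm_image_sub_le_of_norm_hasDerivWithin_le (𝕜 := ℝ)
      (fun r _ => (hd r).hasDerivWithinAt) h1 h0 ⟨neg_abs_le β, le_abs_self β⟩
    rw [dilS_zero, Complex.ofReal_zero, zero_mul, add_zero, sub_zero, Real.norm_eq_abs] at h4
    calc _ = ‖dilS β u x + (β : ℂ) * eulerOp u x - u x‖ := by congr 1; ring
      _ ≤ _ := h4
      _ = _ := by rw [hM]; ring
  set g := memLp_inv_one_add_sq.toLp _ with hg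
  have hnorm : ∀ β : ℝ, |β| ≤ 1 → ‖schwartzToL2 (dilS β u) - schwartzToL2 u
      + (β : ℂ) • schwartzToL2 (eulerOp u)‖ ≤ C * |β| ^ 2 * ‖g‖ := fun β hβ => by
    rw [← map_smul, ← map_sub, ← map_add]
    refine Lp.norm_le_mul_norm_of_ae_le_mul ?_
    filter_upwards [(dilS β u - u + (β : ℂ) • eulerOp u).coeFn_toLp 2 volume,
      memLp_inv_one_add_sq.coeFn_toLp] with x hx1 hx2
    rw [SchwartzMap.toLpCLM_apply, hx1, hg, hx2, Real.norm_eq_abs,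
      abs_of_nonneg (by positivity : (0 : ℝ) ≤ (1 + x ^ 2)⁻¹)]
    exact hpt β x hβ
  rw [hasDerivAt_iff_isLittleO_nhds_zero]
  have hO : (fun β : ℝ => schwartzToL2 (dilS (0 + β) u) - schwartzToL2 (dilS 0 u)
      - β • -schwartzToL2 (eulerOp u)) =O[𝓝 0] fun β : ℝ => β ^ 2 := by
    refine Asymptotics.IsBigO.of_bound (C * ‖g‖) ?_
    filter_upwards [Metric.closedBall_mem_nhds (0 : ℝ) one_pos] with β hβ
    rw [mem_closedBall_zero_iff, Real.norm_eq_abs] at hβ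
    have hsm : β • schwartzToL2 (eulerOp u) = (β : ℂ) • schwartzToL2 (eulerOp u) :=
      (Complex.coe_smul β (schwartzToL2 (eulerOp u))).symm
    rw [zero_add, dilS_zero, smul_neg, sub_neg_eq_add, hsm, norm_pow,
      Real.norm_eq_abs]
    refine (hnorm β hβ).trans (le_of_eq (by ring))
  exact hO.trans_isLittleO (Asymptotics.isLittleO_pow_id one_lt_two)

theorem hasDerivAt_dilS (u : SchwartzMap ℝ ℂ) (β : ℝ) :
    HasDerivAt (fun s => schwartzToL2 (dilS s u)) (-schwartzToL2 (dilS β (eulerOp u))) β := by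
  have h := hasDerivAt_dilS_zero (dilS β u)
  rw [eulerOp_dilS, ← sub_self β] at h
  have h2 := h.comp_sub_const β β
  simpa only [← dilS_add, sub_add_cancel] using h2

/-- Obtained by differentiating the invariance of the inner product under dilations at `β = 0`, in
place of an integration by parts. -/
theorem inner_eulerOp (u v : SchwartzMap ℝ ℂ) :
    inner ℂ (schwartzToL2 u) (schwartzToL2 (eulerOp v)) =
      -inner ℂ (schwartzToL2 (eulerOp u)) (schwartzToL2 v) := by
  have h := (hasDerivAt_dilS_zero u).inner ℂ (hasDerivAt_dilS_zero v)
  simp only [inner_dilS, dilS_zero, inner_neg_left, inner_neg_right] at h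
  have h1 := h.unique (hasDerivAt_const _ _)
  linear_combination -h1

end NormalFormPropagation

end

/-! ### Self-adjointness of real polynomials in the dilation generator -/

noncomputable section

namespace NormalFormPropagation

open Filter Topology Polynomial

/-- The symmetric generator `-i (x ∂ₓ + 1/2)` of the dilations, i.e. `ħ⁻¹ Op_ħ^w(xξ)`. -/
def dilGen : Module.End ℂ (SchwartzMap ℝ ℂ) := (-Complex.I) • eulerOp

theorem inner_dilGen (u v : SchwartzMap ℝ ℂ) :
    inner ℂ (schwartzToL2 u) (schwartzToL2 (dilGen v)) =
      inner ℂ (schwartzToL2 (dilGen u)) (schwartzToL2 v) := by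
  have h := inner_eulerOp u v
  simp only [dilGen, LinearMap.smul_apply, map_smul, inner_smul_left, inner_smul_right, map_neg,
    Complex.conj_I]
  rw [h]
  ring

theorem inner_aeval_dilGen (p : ℝ[X]) (u v : SchwartzMap ℝ ℂ) :
    inner ℂ (schwartzToL2 u) (schwartzToL2 (aeval dilGen (p.map Complex.ofRealHom) v)) =
      inner ℂ (schwartzToL2 (aeval dilGen (p.map Complex.ofRealHom) u)) (schwartzToL2 v) := by
  induction p using Polynomial.induction_on' with
  | add p q hp hq =>
    simp only [Polynomial.map_add, map_add, LinearMap.add_apply, inner_add_left, inner_add_right,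
      hp, hq]
  | monomial n a =>
    have h : ∀ u v, inner ℂ (schwartzToL2 u) (schwartzToL2 ((dilGen ^ n) v)) =
        inner ℂ (schwartzToL2 ((dilGen ^ n) u)) (schwartzToL2 v) := by
      induction n with
      | zero => intro u v; rfl
      | succ n ih =>
        intro u v
        rw [pow_succ', Module.End.mul_apply, inner_dilGen, ih, ← Module.End.mul_apply, ← pow_succ,
          ← pow_succ']
    simp only [Polynomial.map_monomial, aeval_monomial, Module.End.mul_apply,
      Module.algebraMap_end_apply, map_smul, inner_smul_left, inner_smul_right, h,
      Complex.ofRealHom_eq_coe, Complex.conj_ofReal]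

theorem aeval_dilGen (p : ℂ[X]) :
    aeval dilGen p = aeval eulerOp (p.comp (C (-Complex.I) * X)) := by
  rw [aeval_comp]
  congr 1
  rw [map_mul, aeval_C, aeval_X, ← Algebra.smul_def]
  rfl

theorem aeval_dilGen_dilS (β : ℝ) (p : ℂ[X]) (u : SchwartzMap ℝ ℂ) :
    aeval dilGen p (dilS β u) = dilS β (aeval dilGen p u) := by
  rw [aeval_dilGen, aeval_eulerOp_dilS]

theorem eq_zero_of_norm_mul_exp_le {k : ℂ} {a M : ℝ} (ha : a ≠ 0)
    (h : ∀ β : ℝ, ‖k‖ ≤ M * Real.exp (a * β)) : k = 0 := by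
  have h1 : Tendsto (fun s : ℝ => M * Real.exp (-s)) atTop (𝓝 (M * 0)) :=
    (Real.tendsto_exp_neg_atTop_nhds_zero).const_mul M
  have h2 : ‖k‖ ≤ M * 0 := ge_of_tendsto' h1 fun s => by
    -- The choice `β = -s/a` sends `aβ` to `-∞` whatever the sign of `a`.
    have := h (-s / a)
    rwa [mul_div_cancel₀ _ ha] at this
  rw [mul_zero] at h2
  exact norm_le_zero_iff.1 h2

/-- Linear factors are removed one at a time. For a factor `x∂ + 1/2 - a`, orthogonality along the
dilation orbit gives `k' = -a k` for the matrix element `k(β)`. The solution is exponential, while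
unitarity keeps it bounded, so `Re a ≠ 0` forces `k = 0`. -/
theorem inner_eq_zero_of_orthogonal_prod (s : Multiset ℂ) (hs : ∀ μ ∈ s, μ.re ≠ 0) (v : L2)
    (hv : ∀ w, inner ℂ v (schwartzToL2
      (aeval eulerOp (s.map fun a => X - C a).prod w)) = 0) (w : SchwartzMap ℝ ℂ) :
    inner ℂ v (schwartzToL2 w) = 0 := by
  induction s using Multiset.induction_on generalizing w with
  | empty => simpa using hv w
  | cons a s ih =>
    refine ih (fun μ hμ => hs μ (Multiset.mem_cons_of_mem hμ)) (fun w => ?_) w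
    set p := (s.map fun a => (X : ℂ[X]) - C a).prod with hp
    let k : ℝ → ℂ := fun β => inner ℂ v (schwartzToL2 (dilS β (aeval eulerOp p w)))
    have hk : ∀ β, HasDerivAt k (-(a * k β)) β := fun β => by
      have h1 := (hasDerivAt_const β v).inner ℂ (hasDerivAt_dilS (aeval eulerOp p w) β)
      rw [inner_zero_left, add_zero, inner_neg_right] at h1
      refine h1.congr_deriv ?_
      have h2 := hv (dilS β w)
      rw [Multiset.map_cons, Multiset.prod_cons, map_mul, Module.End.mul_apply,
        aeval_eulerOp_dilS, map_sub, aeval_X, aeval_C, LinearMap.sub_apply,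
        Module.algebraMap_end_apply, map_sub, map_smul, inner_sub_right, inner_smul_right,
        eulerOp_dilS] at h2
      rw [sub_eq_zero.1 h2]
    have hconst : ∀ β : ℝ, k β * Complex.exp (a * β) = k 0 := fun β => by
      have hd : ∀ β : ℝ, HasDerivAt (fun β : ℝ => k β * Complex.exp (a * β)) 0 β := fun β => by
        have h1 : HasDerivAt (fun β : ℝ => Complex.exp (a * β)) (Complex.exp (a * β) * a) β := by
          have := (((hasDerivAt_id β).ofReal_comp).const_mul a).cexp
          simpa using this
        refine ((hk β).mul h1).congr_deriv ?_
        ring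
      have h := is_const_of_deriv_eq_zero (fun s => (hd s).differentiableAt)
        (fun s => (hd s).deriv) β 0
      simpa using h
    have h0 : k 0 = 0 := by
      refine eq_zero_of_norm_mul_exp_le (M := ‖v‖ * ‖schwartzToL2 (aeval eulerOp p w)‖)
        (hs a (Multiset.mem_cons_self a s)) fun β => ?_
      rw [← hconst β, norm_mul, Complex.norm_exp]
      have h1 : (a * (β : ℂ)).re = a.re * β := by simp
      rw [h1]
      refine mul_le_mul_of_nonneg_right ?_ (Real.exp_pos _).le
      rw [← norm_dilS β (aeval eulerOp p w)]
      exact norm_inner_le_norm _ _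
    simpa only [k, dilS_zero] using h0

theorem eq_zero_of_inner_schwartz {v : L2} (hv : ∀ w, inner ℂ v (schwartzToL2 w) = 0) : v = 0 := by
  have hd : DenseRange schwartzToL2 := SchwartzMap.denseRange_toLpCLM ENNReal.ofNat_ne_top
  have h : (fun f : L2 => inner ℂ v f) = fun _ => 0 :=
    hd.equalizer (by fun_prop) continuous_const (funext hv)
  exact inner_self_eq_zero.1 (congrFun h v)

theorem dense_range_aeval_eulerOp {F : ℂ[X]} (hF : ∀ z : ℂ, z.re = 0 → F.eval z ≠ 0) :
    Dense {h : L2 | ∃ w, schwartzToL2 (aeval eulerOp F w) = h} := by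
  let W : Submodule ℂ L2 := LinearMap.range (schwartzToL2.toLinearMap ∘ₗ (aeval eulerOp F))
  have hW : {h : L2 | ∃ w, schwartzToL2 (aeval eulerOp F w) = h} = W := rfl
  rw [hW, Submodule.dense_iff_topologicalClosure_eq_top,
    Submodule.topologicalClosure_eq_top_iff, Submodule.eq_bot_iff]
  intro v hv
  have hF0 : F ≠ 0 := fun h => hF 0 rfl (by rw [h, eval_zero])
  refine eq_zero_of_inner_schwartz
    (inner_eq_zero_of_orthogonal_prod F.roots (fun μ hμ h => ?_) v fun w => ?_)
  · exact hF μ h (isRoot_of_mem_roots hμ)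
  · have h1 : inner ℂ v (schwartzToL2 (aeval eulerOp F w)) = 0 := by
      rw [Submodule.mem_orthogonal'] at hv
      exact hv _ ⟨w, rfl⟩
    rw [(IsAlgClosed.splits F).eq_prod_roots, map_mul, aeval_C, Module.End.mul_apply,
      Module.algebraMap_end_apply, map_smul, inner_smul_right] at h1
    exact (mul_eq_zero.1 h1).resolve_left (leadingCoeff_ne_zero.2 hF0)

/-- The graph of `-i p(dilGen)` on Schwartz functions. -/
def polyGraph (p : ℝ[X]) : Submodule ℂ (L2 × L2) :=
  LinearMap.range (schwartzToL2.toLinearMap.prod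
    ((-Complex.I) • (schwartzToL2.toLinearMap ∘ₗ (aeval dilGen (p.map Complex.ofRealHom)))))

theorem mem_polyGraph {p : ℝ[X]} {x : L2 × L2} : x ∈ polyGraph p ↔
    ∃ u, schwartzToL2 u = x.1 ∧
      (-Complex.I) • schwartzToL2 (aeval dilGen (p.map Complex.ofRealHom) u) = x.2 := by
  rw [polyGraph, LinearMap.mem_range]
  exact exists_congr fun u => Prod.ext_iff

theorem polyGraph_skew {p : ℝ[X]} {x y : L2 × L2} (hx : x ∈ (polyGraph p).topologicalClosure)
    (hy : y ∈ (polyGraph p).topologicalClosure) :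
    inner ℂ x.1 y.2 + inner ℂ x.2 y.1 = 0 := by
  have h0 : ∀ x ∈ polyGraph p, ∀ y ∈ polyGraph p, inner ℂ x.1 y.2 + inner ℂ x.2 y.1 = 0 := by
    intro x hx y hy
    obtain ⟨u, hu1, hu2⟩ := mem_polyGraph.1 hx
    obtain ⟨v, hv1, hv2⟩ := mem_polyGraph.1 hy
    rw [← hu1, ← hu2, ← hv1, ← hv2, inner_smul_left, inner_smul_right, inner_aeval_dilGen]
    simp
  have h1 : ∀ x ∈ polyGraph p, ∀ y ∈ (polyGraph p).topologicalClosure,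
      inner ℂ x.1 y.2 + inner ℂ x.2 y.1 = 0 := fun x hx y hy => by
    have hcl : IsClosed {y : L2 × L2 | inner ℂ x.1 y.2 + inner ℂ x.2 y.1 = 0} :=
      isClosed_eq (by fun_prop) continuous_const
    exact closure_minimal (fun y hy => h0 x hx y hy) hcl hy
  have hcl : IsClosed {x : L2 × L2 | inner ℂ x.1 y.2 + inner ℂ x.2 y.1 = 0} :=
    isClosed_eq (by fun_prop) continuous_const
  exact closure_minimal (fun x hx => h1 x hx y hy) hcl hx

theorem exists_unitaryGroup_polyGraph (p : ℝ[X]) :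
    ∃ U : ℝ → L2 ≃ₗᵢ[ℂ] L2, (∀ f, U 0 f = f) ∧ (∀ s t f, U (s + t) f = U s (U t f)) ∧
      (∀ f, Continuous fun t => U t f) ∧
      ∀ f g, (f, g) ∈ closure (polyGraph p : Set (L2 × L2)) ↔
        HasDerivAt (fun t => U t f) g 0 := by
  refine exists_unitaryGroup (Γ := (polyGraph p).topologicalClosure)
    (Submodule.isClosed_topologicalClosure _)
    (fun x hx y hy => polyGraph_skew hx hy) ?_ fun n hn => ?_
  · have hd : DenseRange schwartzToL2 := SchwartzMap.denseRange_toLpCLM ENNReal.ofNat_ne_top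
    refine Dense.mono ?_ hd
    rintro _ ⟨u, rfl⟩
    exact ⟨_, Submodule.le_topologicalClosure _ (mem_polyGraph.2 ⟨u, rfl, rfl⟩)⟩
  -- The shift `n + i p(D)` is written as a polynomial in `eulerOp` through `D = -i eulerOp`. At `z
  -- = iy` its value is `n + i p(y)`, with real part `n ≠ 0`.
  · have hd := dense_range_aeval_eulerOp (F := C (n : ℂ) -
      C (-Complex.I) * (p.map Complex.ofRealHom).comp (C (-Complex.I) * X)) fun z hz => by
        have h1 : -Complex.I * z = (z.im : ℂ) := by
          apply Complex.ext <;> simp [hz]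
        rw [eval_sub, eval_C, eval_mul, eval_C, eval_comp, eval_mul, eval_C, eval_X, h1,
          eval_map, ← Complex.ofRealHom_eq_coe z.im, eval₂_at_apply]
        intro h2
        have h3 := congrArg Complex.re h2
        simp at h3
        exact hn h3
    refine Dense.mono ?_ hd
    rintro _ ⟨w, rfl⟩
    refine ⟨(_, _), Submodule.le_topologicalClosure _ (mem_polyGraph.2 ⟨w, rfl, rfl⟩), ?_⟩
    rw [map_sub, aeval_C, map_mul, aeval_C, ← aeval_dilGen, LinearMap.sub_apply,
      Module.End.mul_apply, Module.algebraMap_end_apply, Module.algebraMap_end_apply, map_sub,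
      map_smul, map_smul]
    rfl

end NormalFormPropagation

end

noncomputable section

namespace NormalFormPropagation

open Filter Topology Polynomial

/-! ### Weyl quantization of `(xξ)^α` -/

/-- The polynomials with `Op_ħ^w((xξ)^α) = ħ^α p_α(ħ⁻¹ Op_ħ^w(xξ))`. -/
def weylPoly : ℕ → ℝ[X]
  | 0 => 1
  | 1 => X
  | n + 2 => X * weylPoly (n + 1) - C (((n : ℝ) + 1) ^ 2 / 4) * weylPoly n

/-- The coefficients of `p_α` in the basis `x^j ∂^j`. -/
def weylCoeff (α j : ℕ) : ℂ :=
  if j ≤ α then (α.factorial : ℂ) ^ 2 / ((j.factorial : ℂ) ^ 2 * (α - j).factorial * 2 ^ (α - j))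
  else 0

theorem weylCoeff_of_lt {α j : ℕ} (h : α < j) : weylCoeff α j = 0 := if_neg (not_le.2 h)

theorem weylCoeff_add (j n : ℕ) : weylCoeff (j + n) j =
    ((j + n).factorial : ℂ) ^ 2 / ((j.factorial : ℂ) ^ 2 * n.factorial * 2 ^ n) := by
  rw [weylCoeff, if_pos (Nat.le_add_right j n), Nat.add_sub_cancel_left]

theorem weylCoeff_self (j : ℕ) : weylCoeff j j = 1 := by
  have h := weylCoeff_add j 0
  have h1 : (j.factorial : ℂ) ≠ 0 := by exact_mod_cast j.factorial_ne_zero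
  rw [add_zero] at h
  rw [h]
  simp [h1]

theorem weylCoeff_zero_right (α : ℕ) : weylCoeff (α + 2) 0 =
    1 / 2 * weylCoeff (α + 1) 0 + ((α : ℂ) + 1) ^ 2 / 4 * weylCoeff α 0 := by
  have h0 := weylCoeff_add 0 α
  have h1 := weylCoeff_add 0 (α + 1)
  have h2 := weylCoeff_add 0 (α + 2)
  simp only [zero_add] at h0 h1 h2
  rw [h0, h1, h2]
  have hf : (α.factorial : ℂ) ≠ 0 := by exact_mod_cast α.factorial_ne_zero
  have ha : (α : ℂ) + 1 ≠ 0 := by exact_mod_cast α.succ_ne_zero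
  have hb : (α : ℂ) + 2 ≠ 0 := by exact_mod_cast (α + 1).succ_ne_zero
  simp only [Nat.factorial_succ, pow_succ, Nat.factorial_zero]
  push_cast
  rw [show (α : ℂ) + 1 + 1 = α + 2 by ring]
  field_simp
  ring

/-- The recurrence of `weylDiffOp_succ_succ` read off at `x^{j+1}∂^{j+1}`: applying `eulerOp` to
`x^j∂^j` raises the index by one and adds `j + 1/2` times the same monomial, which is `j + 3/2` at
index `j + 1`. -/
theorem weylCoeff_succ_right (α j : ℕ) : weylCoeff (α + 2) (j + 1) =
    weylCoeff (α + 1) j + ((j : ℂ) + 3 / 2) * weylCoeff (α + 1) (j + 1) +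
      ((α : ℂ) + 1) ^ 2 / 4 * weylCoeff α (j + 1) := by
  rcases lt_trichotomy j α with h | rfl | h
  · obtain ⟨n, rfl⟩ := Nat.exists_eq_add_of_lt h
    have h1 := weylCoeff_add (j + 1) (n + 2)
    have h2 := weylCoeff_add j (n + 2)
    have h3 := weylCoeff_add (j + 1) (n + 1)
    have h4 := weylCoeff_add (j + 1) n
    rw [show j + 1 + (n + 2) = j + n + 1 + 2 by ring] at h1
    rw [show j + (n + 2) = j + n + 1 + 1 by ring] at h2
    rw [show j + 1 + (n + 1) = j + n + 1 + 1 by ring] at h3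
    rw [show j + 1 + n = j + n + 1 by ring] at h4
    rw [h1, h2, h3, h4]
    have hf : ((j + n).factorial : ℂ) ≠ 0 := by exact_mod_cast (j + n).factorial_ne_zero
    have hj : (j.factorial : ℂ) ≠ 0 := by exact_mod_cast j.factorial_ne_zero
    have hn : (n.factorial : ℂ) ≠ 0 := by exact_mod_cast n.factorial_ne_zero
    have hj1 : (j : ℂ) + 1 ≠ 0 := by exact_mod_cast j.succ_ne_zero
    have hn1 : (n : ℂ) + 1 ≠ 0 := by exact_mod_cast n.succ_ne_zero
    have hn2 : (n : ℂ) + 2 ≠ 0 := by exact_mod_cast (n + 1).succ_ne_zero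
    have hjn : (j : ℂ) + n + 1 ≠ 0 := by exact_mod_cast (j + n).succ_ne_zero
    simp only [Nat.factorial_succ, pow_succ]
    push_cast
    rw [show (n : ℂ) + 1 + 1 = n + 2 by ring]
    field_simp
    ring
  · rw [weylCoeff_self, weylCoeff_of_lt (Nat.lt_succ_self j)]
    have h1 := weylCoeff_add (j + 1) 1
    have h2 := weylCoeff_add j 1
    rw [show j + 1 + 1 = j + 2 by ring] at h1
    rw [h1, h2]
    have hj : (j.factorial : ℂ) ≠ 0 := by exact_mod_cast j.factorial_ne_zero
    have hj1 : (j : ℂ) + 1 ≠ 0 := by exact_mod_cast j.succ_ne_zero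
    simp only [Nat.factorial_succ, pow_succ]
    push_cast
    field_simp
    ring
  · rcases eq_or_lt_of_le (Nat.succ_le_of_lt h) with rfl | h
    · rw [weylCoeff_self, weylCoeff_self, weylCoeff_of_lt (by omega), weylCoeff_of_lt (by omega)]
      ring
    · rw [weylCoeff_of_lt (by omega), weylCoeff_of_lt (by omega), weylCoeff_of_lt (by omega),
        weylCoeff_of_lt (by omega)]
      ring

theorem derivS_mul_mulX : derivS * mulX = mulX * derivS + 1 := by
  ext u x
  have h1 : (mulX u : ℝ → ℂ) = fun x : ℝ => (x : ℂ) * u x := funext (mulX_apply u)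
  have h2 := (Complex.ofRealCLM.hasDerivAt (x := x)).mul (hasDerivAt_schwartz u x)
  rw [Module.End.mul_apply, derivS_apply, h1]
  refine h2.deriv.trans ?_
  simp
  ring

theorem mulX_derivS_mulX_pow (j : ℕ) :
    mulX * derivS * mulX ^ j = mulX ^ (j + 1) * derivS + (j : ℂ) • mulX ^ j := by
  induction j with
  | zero => simp
  | succ j ih =>
    rw [pow_succ, ← mul_assoc, ih, add_mul, mul_assoc, derivS_mul_mulX, mul_add, ← mul_assoc,
      ← pow_succ, smul_mul_assoc, ← pow_succ, mul_one]
    push_cast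
    module

theorem eulerOp_mul_monomial (j : ℕ) : eulerOp * (mulX ^ j * derivS ^ j) =
    mulX ^ (j + 1) * derivS ^ (j + 1) + ((j : ℂ) + 1 / 2) • (mulX ^ j * derivS ^ j) := by
  rw [eulerOp, add_mul, ← mul_assoc, mulX_derivS_mulX_pow, add_mul, mul_assoc, ← pow_succ',
    smul_mul_assoc, smul_mul_assoc, one_mul]
  module

/-- The operator `∑_j a_{α,j} x^j ∂^j`. -/
def weylDiffOp (α : ℕ) : Module.End ℂ (SchwartzMap ℝ ℂ) :=
  ∑ j ∈ Finset.range (α + 1), weylCoeff α j • (mulX ^ j * derivS ^ j)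

theorem weylDiffOp_eq {α n : ℕ} (h : α < n) : weylDiffOp α =
    ∑ j ∈ Finset.range n, weylCoeff α j • (mulX ^ j * derivS ^ j) := by
  refine Finset.sum_subset (Finset.range_mono h) fun j _ hj => ?_
  rw [weylCoeff_of_lt (by simpa using hj), zero_smul]

theorem weylDiffOp_succ_succ (α : ℕ) : weylDiffOp (α + 2) =
    eulerOp * weylDiffOp (α + 1) + (((α : ℂ) + 1) ^ 2 / 4) • weylDiffOp α := by
  have h1 : eulerOp * weylDiffOp (α + 1) =
      ∑ j ∈ Finset.range (α + 2), weylCoeff (α + 1) j • (mulX ^ (j + 1) * derivS ^ (j + 1)) +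
      ∑ j ∈ Finset.range (α + 3),
        (weylCoeff (α + 1) j * ((j : ℂ) + 1 / 2)) • (mulX ^ j * derivS ^ j) := by
    have h2 : ∑ j ∈ Finset.range (α + 3),
        (weylCoeff (α + 1) j * ((j : ℂ) + 1 / 2)) • (mulX ^ j * derivS ^ j) =
        ∑ j ∈ Finset.range (α + 2),
        (weylCoeff (α + 1) j * ((j : ℂ) + 1 / 2)) • (mulX ^ j * derivS ^ j) := by
      rw [Finset.sum_range_succ, weylCoeff_of_lt (by omega), zero_mul, zero_smul, add_zero]
    rw [h2, weylDiffOp, Finset.mul_sum, ← Finset.sum_add_distrib]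
    refine Finset.sum_congr rfl fun j _ => ?_
    rw [mul_smul_comm, eulerOp_mul_monomial, smul_add, smul_smul]
  rw [h1, weylDiffOp, weylDiffOp_eq (show α < α + 3 by omega), Finset.smul_sum,
    add_assoc (Finset.sum _ _), ← Finset.sum_add_distrib, Finset.sum_range_succ',
    Finset.sum_range_succ' _ (α + 2), ← add_assoc (Finset.sum _ _), ← Finset.sum_add_distrib]
  congr 1
  · refine Finset.sum_congr rfl fun j _ => ?_
    rw [weylCoeff_succ_right]
    push_cast
    module
  · rw [weylCoeff_zero_right]
    push_cast
    module

/-- One factor `-i` turns `eulerOp` into `dilGen`, and `(-i)² = -1` turns the plus sign of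
`weylDiffOp_succ_succ` into the minus sign in `weylPoly`. -/
theorem weylDiffOp_eq_aeval (α : ℕ) : (-Complex.I) ^ α • weylDiffOp α =
    aeval dilGen ((weylPoly α).map Complex.ofRealHom) := by
  induction α using Nat.twoStepInduction with
  | zero => simp [weylDiffOp, weylPoly, weylCoeff]
  | one =>
    rw [weylPoly, Polynomial.map_X, aeval_X, dilGen, eulerOp, weylDiffOp, pow_one,
      Finset.sum_range_succ, Finset.sum_range_one, weylCoeff_self]
    simp [weylCoeff, add_comm]
  | more α ih0 ih1 =>
    rw [weylDiffOp_succ_succ, weylPoly, Polynomial.map_sub, Polynomial.map_mul, Polynomial.map_X,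
      Polynomial.map_mul, Polynomial.map_C, map_sub, map_mul, aeval_X, map_mul, aeval_C, ← ih1,
      ← ih0, dilGen, smul_mul_smul_comm, ← Algebra.smul_def, smul_add, smul_smul, smul_smul]
    have h : (-Complex.I) ^ (α + 2) = - (-Complex.I) ^ α := by
      rw [pow_add, neg_sq, Complex.I_sq]; ring
    rw [h, ← pow_succ', show α + 1 + 1 = α + 2 by ring, h, Complex.ofRealHom_eq_coe]
    push_cast
    module

theorem derivS_pow_apply (n : ℕ) (u : SchwartzMap ℝ ℂ) :
    ((derivS ^ n) u : ℝ → ℂ) = iteratedDeriv n u := by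
  induction n with
  | zero => simp
  | succ n ih =>
    rw [pow_succ', iteratedDeriv_succ, ← ih]
    rfl

theorem mulX_pow_apply (n : ℕ) (u : SchwartzMap ℝ ℂ) (x : ℝ) :
    (mulX ^ n) u x = (x : ℂ) ^ n * u x := by
  induction n with
  | zero => simp
  | succ n ih => rw [pow_succ', Module.End.mul_apply, mulX_apply, ih]; ring

/-- Multiplication by the average of the coordinate and `x`. -/
def avgX (x : ℝ) : Module.End ℂ (SchwartzMap ℝ ℂ) := (1 / 2 : ℂ) • ((x : ℂ) • 1 + mulX)

theorem avgX_pow_apply (x : ℝ) (n : ℕ) (u : SchwartzMap ℝ ℂ) (y : ℝ) :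
    (avgX x ^ n) u y = ((x + y : ℂ) / 2) ^ n * u y := by
  induction n with
  | zero => simp
  | succ n ih =>
    rw [pow_succ', Module.End.mul_apply]
    simp only [avgX, LinearMap.smul_apply, LinearMap.add_apply, Module.End.one_apply] at ih ⊢
    simp only [smul_apply, add_apply, mulX_apply, ih, smul_eq_mul]
    ring

theorem iteratedDeriv_avg_pow (x : ℝ) (α i : ℕ) (y : ℝ) :
    iteratedDeriv i (fun y : ℝ => ((x + y : ℂ) / 2) ^ α) y =
      (α.descFactorial i : ℂ) * (1 / 2) ^ i * ((x + y : ℂ) / 2) ^ (α - i) := by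
  induction i generalizing y with
  | zero => simp
  | succ i ih =>
    rw [iteratedDeriv_succ, funext ih]
    have h1 : HasDerivAt (fun y : ℝ => ((x + y : ℂ) / 2)) (1 / 2) y :=
      ((Complex.ofRealCLM.hasDerivAt (x := y)).const_add (x : ℂ)).div_const 2
    have h2 := (h1.pow (α - i)).const_mul ((α.descFactorial i : ℂ) * (1 / 2) ^ i)
    refine h2.deriv.trans ?_
    rw [Nat.descFactorial_succ, Nat.sub_add_eq]
    push_cast
    ring

/-- The right side is `∂_y^α [((x + y)/2)^α u(y)]` at `y = x`, the form in which the Weyl integral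
delivers the operator. Leibniz's rule produces the coefficients `weylCoeff`. -/
theorem weylDiffOp_apply (α : ℕ) (u : SchwartzMap ℝ ℂ) (x : ℝ) :
    weylDiffOp α u x = (derivS ^ α) ((avgX x ^ α) u) x := by
  have hu : ContDiffAt ℝ α u x := u.contDiffAt α
  have hp : ContDiffAt ℝ α (fun y : ℝ => ((x + y : ℂ) / 2) ^ α) x := by
    have h : ContDiff ℝ α (fun y : ℝ => (y : ℂ)) := Complex.ofRealCLM.contDiff
    fun_prop
  have h1 : ((avgX x ^ α) u : ℝ → ℂ) = (fun y : ℝ => ((x + y : ℂ) / 2) ^ α) * u :=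
    funext (avgX_pow_apply x α u)
  rw [derivS_pow_apply, h1, iteratedDeriv_mul hp hu, ← Finset.sum_range_reflect, weylDiffOp,
    LinearMap.sum_apply, sum_apply]
  refine Finset.sum_congr rfl fun j hj => ?_
  obtain ⟨n, rfl⟩ := Nat.exists_eq_add_of_le (Nat.lt_succ_iff.1 (Finset.mem_range.1 hj))
  have e1 : j + n + 1 - 1 - j = n := by omega
  have e2 : j + n - n = j := by omega
  rw [e1, e2, iteratedDeriv_avg_pow, weylCoeff_add, LinearMap.smul_apply, smul_apply,
    Module.End.mul_apply, mulX_pow_apply, derivS_pow_apply, e2, add_self_div_two, smul_eq_mul,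
    Nat.cast_choose ℂ (Nat.le_add_left n j), e2]
  have hd : ((j + n).descFactorial n : ℂ) = (j + n).factorial / j.factorial := by
    rw [Nat.descFactorial_eq_div (by omega), e2,
      Nat.cast_div (Nat.factorial_dvd_factorial (by omega))
        (by exact_mod_cast j.factorial_ne_zero)]
  have hj : (j.factorial : ℂ) ≠ 0 := by exact_mod_cast j.factorial_ne_zero
  have hn : (n.factorial : ℂ) ≠ 0 := by exact_mod_cast n.factorial_ne_zero
  rw [hd, one_div, inv_pow]
  field_simp

end NormalFormPropagation

end

/-! ### Weyl operators computed by Fourier inversion -/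

noncomputable section

namespace NormalFormPropagation

open Filter Topology Polynomial FourierTransform

theorem fourier_derivS_pow (n : ℕ) (v : SchwartzMap ℝ ℂ) (η : ℝ) :
    𝓕 ((derivS ^ n) v) η = (2 * Real.pi * Complex.I * η) ^ n * 𝓕 v η := by
  induction n with
  | zero => simp
  | succ n ih =>
    rw [pow_succ', Module.End.mul_apply, pow_succ', mul_assoc, ← ih]
    set w := (derivS ^ n) v
    have h := Real.fourier_deriv w.integrable w.differentiable (derivS w).integrable
    exact congrFun h η

theorem integral_oscillatory_mul (ħ x ξ : ℝ) (v : SchwartzMap ℝ ℂ) :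
    ∫ y : ℝ, Complex.exp (Complex.I * ((x - y) * ξ / ħ : ℝ)) * v y =
      Complex.exp (Complex.I * (x * ξ / ħ : ℝ)) * 𝓕 v (ξ / (2 * Real.pi * ħ)) := by
  rw [SchwartzMap.fourier_coe, Real.fourier_real_eq_integral_exp_smul, ← integral_const_mul]
  congr 1
  funext y
  rw [smul_eq_mul, ← mul_assoc, ← Complex.exp_add]
  congr 2
  have h : -2 * Real.pi * y * (ξ / (2 * Real.pi * ħ)) = -(y * ξ / ħ) := by
    have := Real.pi_ne_zero
    field_simp
  rw [h]
  push_cast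
  ring

theorem integral_exp_mul_fourier {ħ : ℝ} (hħ : 0 < ħ) (x : ℝ) (w : SchwartzMap ℝ ℂ) :
    (1 / (2 * Real.pi * ħ) : ℂ) * ∫ ξ : ℝ, Complex.exp (Complex.I * (x * ξ / ħ : ℝ)) *
      𝓕 w (ξ / (2 * Real.pi * ħ)) = w x := by
  have h1 : ∀ ξ : ℝ, Complex.exp (Complex.I * (x * ξ / ħ : ℝ)) * 𝓕 w (ξ / (2 * Real.pi * ħ)) =
      (fun η : ℝ => Complex.exp (↑(2 * Real.pi * η * x) * Complex.I) • 𝓕 w η)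
        (ξ / (2 * Real.pi * ħ)) := fun ξ => by
    have h : 2 * Real.pi * (ξ / (2 * Real.pi * ħ)) * x = x * ξ / ħ := by
      have := Real.pi_ne_zero
      field_simp
    simp only [smul_eq_mul]
    rw [h, mul_comm Complex.I]
  have h2 : (∫ η : ℝ, Complex.exp (↑(2 * Real.pi * η * x) * Complex.I) • 𝓕 w η) = w x := by
    have h3 : 𝓕⁻ (𝓕 w) x = w x := by rw [fourierInv_fourier_eq]
    rw [SchwartzMap.fourierInv_coe, Real.fourierInv_eq'] at h3
    rw [← h3]
    congr 1
    funext η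
    rw [RCLike.inner_apply, RCLike.conj_to_real, mul_comm x, mul_assoc]
  rw [integral_congr_ae (Eventually.of_forall h1), Measure.integral_comp_div
    (fun η : ℝ => Complex.exp (↑(2 * Real.pi * η * x) * Complex.I) • 𝓕 w η), h2, abs_of_pos (by positivity), Complex.real_smul, ← mul_assoc]
  have h3 : (2 * Real.pi * ħ : ℂ) ≠ 0 := by
    have : (2 * Real.pi * ħ : ℝ) ≠ 0 := by positivity
    exact_mod_cast this
  push_cast
  rw [one_div_mul_cancel h3, one_mul]

/-- For fixed `x` the `y`-integral is a Fourier transform, under which the power `ξ^α` corresponds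
to `(-iħ∂_y)^α`; the `ξ`-integral is Fourier inversion at `x`. -/
theorem weylOp_symbolQ (N : ℕ) (q : ℕ → ℕ → ℝ) {ħ : ℝ} (hħ : 0 < ħ) (u : SchwartzMap ℝ ℂ) (x : ℝ) :
    weylOp ħ (symbolQ N q ħ) u x =
      ∑ α ∈ Finset.Icc 1 N, (coeffQ N q ħ α * (-Complex.I * ħ) ^ α) * weylDiffOp α u x := by
  let F := SchwartzMap.fourierTransformCLM ℂ (V := ℝ) (E := ℂ)
  -- The point `x` is frozen in the midpoint factor, so derivatives act in `y` only; `y = x` is set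
  -- after inversion.
  let w : SchwartzMap ℝ ℂ := ∑ α ∈ Finset.Icc 1 N,
    ((coeffQ N q ħ α : ℂ) * (-Complex.I * ħ) ^ α) • (derivS ^ α) ((avgX x ^ α) u)
  have hinner : ∀ ξ : ℝ, ∫ y : ℝ,
      Complex.exp (Complex.I * ((x - y) * ξ / ħ : ℝ)) * symbolQ N q ħ ((x + y) / 2) ξ * u y =
      Complex.exp (Complex.I * (x * ξ / ħ : ℝ)) * 𝓕 w (ξ / (2 * Real.pi * ħ)) := fun ξ => by
    let v : SchwartzMap ℝ ℂ := ∑ α ∈ Finset.Icc 1 N,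
      ((coeffQ N q ħ α : ℂ) * (ξ : ℂ) ^ α) • (avgX x ^ α) u
    have hv : ∀ y : ℝ, symbolQ N q ħ ((x + y) / 2) ξ * u y = v y := fun y => by
      simp only [v, symbolQ, sum_apply, smul_apply, avgX_pow_apply, smul_eq_mul]
      push_cast
      rw [Finset.sum_mul]
      refine Finset.sum_congr rfl fun α _ => ?_
      rw [mul_pow]
      ring
    have hvw : 𝓕 v (ξ / (2 * Real.pi * ħ)) = 𝓕 w (ξ / (2 * Real.pi * ħ)) := by
      change F v _ = F w _
      simp only [v, w, map_sum, map_smul, sum_apply, smul_apply]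
      refine Finset.sum_congr rfl fun α _ => ?_
      change _ • 𝓕 ((avgX x ^ α) u) _ = _ • 𝓕 ((derivS ^ α) ((avgX x ^ α) u)) _
      have h3 : (ħ : ℂ) ≠ 0 := by exact_mod_cast hħ.ne'
      have h4 : (Real.pi : ℂ) ≠ 0 := by exact_mod_cast Real.pi_ne_zero
      have h5 : -Complex.I * ħ * (2 * Real.pi * Complex.I * ↑(ξ / (2 * Real.pi * ħ))) = (ξ : ℂ) := by
        push_cast
        field_simp
        rw [Complex.I_sq]
        ring
      rw [fourier_derivS_pow, smul_eq_mul, smul_eq_mul, ← h5, mul_pow _ (2 * _ * _ * _)]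
      ring
    simp only [mul_assoc _ (symbolQ N q ħ _ ξ), hv]
    rw [integral_oscillatory_mul, hvw]
  rw [weylOp]
  simp only [hinner]
  rw [integral_exp_mul_fourier hħ]
  simp only [w, sum_apply, smul_apply, smul_eq_mul, weylDiffOp_apply]

/-- The real polynomial `ħ⁻¹ ∑_α q^α(ħ) ħ^α p_α`, with the sum over `a ≤ α ≤ N`. -/
def polyQ (N : ℕ) (q : ℕ → ℕ → ℝ) (ħ : ℝ) (a : ℕ) : ℝ[X] :=
  ∑ α ∈ Finset.Icc a N, C (coeffQ N q ħ α * ħ ^ (α - 1)) * weylPoly α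

theorem weylOp_symbolQ_eq (N : ℕ) (q : ℕ → ℕ → ℝ) {ħ : ℝ} (hħ : 0 < ħ) (u : SchwartzMap ℝ ℂ) :
    weylOp ħ (symbolQ N q ħ) u =
      ((ħ : ℂ) • aeval dilGen ((polyQ N q ħ 1).map Complex.ofRealHom) u : SchwartzMap ℝ ℂ) := by
  funext x
  rw [weylOp_symbolQ N q hħ, polyQ]
  simp only [Polynomial.map_sum, Polynomial.map_mul, Polynomial.map_C, map_sum, map_mul, aeval_C,
    LinearMap.sum_apply, Module.End.mul_apply, Module.algebraMap_end_apply, ← weylDiffOp_eq_aeval,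
    Finset.smul_sum, sum_apply, smul_apply, LinearMap.smul_apply, smul_eq_mul, mul_pow,
    Complex.ofRealHom_eq_coe]
  refine Finset.sum_congr rfl fun α hα => ?_
  obtain ⟨n, rfl⟩ := Nat.exists_eq_add_of_le' (Finset.mem_Icc.1 hα).1
  rw [Nat.add_sub_cancel]
  push_cast
  ring

theorem weylGraph_symbolQ (N : ℕ) (q : ℕ → ℕ → ℝ) {ħ : ℝ} (hħ : 0 < ħ) :
    weylGraph ħ (symbolQ N q ħ) = {x | (x.1, -(Complex.I / (ħ : ℂ)) • x.2) ∈ polyGraph (polyQ N q ħ 1)} := by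
  have hne : (ħ : ℂ) ≠ 0 := by exact_mod_cast hħ.ne'
  ext ⟨f, g⟩
  simp only [weylGraph, Set.mem_ofPred_eq, mem_polyGraph]
  refine exists_congr fun u => and_congr ?_ ?_
  · rw [eq_comm, Lp.ext_iff]
    exact ⟨fun h => h.trans (u.coeFn_toLp 2 volume).symm, fun h => h.trans (u.coeFn_toLp 2 volume)⟩
  · rw [weylOp_symbolQ_eq N q hħ u]
    set w := aeval dilGen ((polyQ N q ħ 1).map Complex.ofRealHom) u
    have h1 : (g : ℝ → ℂ) =ᵐ[volume] ((ħ : ℂ) • w : SchwartzMap ℝ ℂ) ↔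
        g = (ħ : ℂ) • schwartzToL2 w := by
      rw [← map_smul schwartzToL2, Lp.ext_iff]
      exact ⟨fun h => h.trans (((ħ : ℂ) • w).coeFn_toLp 2 volume).symm,
        fun h => h.trans (((ħ : ℂ) • w).coeFn_toLp 2 volume)⟩
    rw [h1]
    constructor
    · rintro rfl
      rw [smul_smul, neg_mul, div_mul_cancel₀ _ hne]
    · intro h
      have h2 := congrArg (fun z => ((ħ : ℂ) * Complex.I) • z) h
      simp only [smul_smul] at h2
      rw [show (ħ : ℂ) * Complex.I * -Complex.I = ħ by linear_combination -(ħ : ℂ) * Complex.I_mul_I,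
        show (ħ : ℂ) * Complex.I * -(Complex.I / ħ) = 1 by
          field_simp; rw [Complex.I_sq]; ring, one_smul] at h2
      exact h2.symm

theorem mem_closure_weylGraph (N : ℕ) (q : ℕ → ℕ → ℝ) {ħ : ℝ} (hħ : 0 < ħ) (f g : L2) :
    (f, g) ∈ closure (weylGraph ħ (symbolQ N q ħ)) ↔
      (f, -(Complex.I / (ħ : ℂ)) • g) ∈ closure (polyGraph (polyQ N q ħ 1) : Set (L2 × L2)) := by
  have hne : -(Complex.I / (ħ : ℂ)) ≠ 0 :=
    neg_ne_zero.2 (div_ne_zero Complex.I_ne_zero (by exact_mod_cast hħ.ne'))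
  let e : L2 × L2 ≃ₜ L2 × L2 := (Homeomorph.refl L2).prodCongr (Homeomorph.smulOfNeZero _ hne)
  have h : weylGraph ħ (symbolQ N q ħ) = e ⁻¹' (polyGraph (polyQ N q ħ 1) : Set (L2 × L2)) :=
    weylGraph_symbolQ N q hħ
  rw [h, ← e.preimage_closure]
  rfl

theorem isSchrodingerGroup_schrodingerGroup (N : ℕ) (q : ℕ → ℕ → ℝ) {ħ : ℝ} (hħ : 0 < ħ) :
    IsSchrodingerGroup ħ (symbolQ N q ħ) (schrodingerGroup ħ (symbolQ N q ħ)) := by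
  have h : ∃ U, IsSchrodingerGroup ħ (symbolQ N q ħ) U := by
    obtain ⟨U, h0, hadd, hcont, hgen⟩ := exists_unitaryGroup_polyGraph (polyQ N q ħ 1)
    exact ⟨U, h0, hadd, hcont, fun f g => (mem_closure_weylGraph N q hħ f g).trans (hgen _ _)⟩
  -- Since a group exists, the identity default in `schrodingerGroup` is not taken.
  rw [schrodingerGroup, dif_pos h]
  exact h.choose_spec

end NormalFormPropagation

end

noncomputable section

namespace NormalFormPropagation

open Filter Topology Polynomial

/-! ### Hermite functions -/

theorem exists_bound_pow_mul_gaussian (n : ℕ) :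
    ∃ C : ℝ, ∀ x : ℝ, |x| ^ n * Real.exp (-x ^ 2 / 2) ≤ C := by
  refine ⟨n.factorial * Real.exp (1 / 2), fun x => ?_⟩
  have h1 := Real.pow_div_factorial_le_exp |x| (abs_nonneg x) n
  rw [div_le_iff₀ (by positivity)] at h1
  calc |x| ^ n * Real.exp (-x ^ 2 / 2)
      ≤ Real.exp |x| * n.factorial * Real.exp (-x ^ 2 / 2) := by gcongr
    _ = n.factorial * Real.exp (|x| + -x ^ 2 / 2) := by rw [Real.exp_add]; ring
    _ ≤ n.factorial * Real.exp (1 / 2) := by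
        gcongr
        nlinarith [sq_nonneg (|x| - 1), sq_abs x]

theorem exists_bound_eval_mul_gaussian (p : ℂ[X]) :
    ∃ C : ℝ, ∀ x : ℝ, ‖p.eval (x : ℂ) * (Real.exp (-x ^ 2 / 2) : ℂ)‖ ≤ C := by
  induction p using Polynomial.induction_on' with
  | add p q hp hq =>
    obtain ⟨C, hC⟩ := hp
    obtain ⟨D, hD⟩ := hq
    refine ⟨C + D, fun x => ?_⟩
    rw [eval_add, add_mul]
    exact (norm_add_le _ _).trans (add_le_add (hC x) (hD x))
  | monomial n a =>
    obtain ⟨C, hC⟩ := exists_bound_pow_mul_gaussian n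
    refine ⟨‖a‖ * C, fun x => ?_⟩
    rw [eval_monomial, mul_assoc, norm_mul, norm_mul, norm_pow, Complex.norm_real,
      Complex.norm_real, Real.norm_eq_abs, Real.norm_eq_abs, abs_of_pos (Real.exp_pos _)]
    exact mul_le_mul_of_nonneg_left (hC x) (norm_nonneg a)

theorem hasDerivAt_gaussian (x : ℝ) :
    HasDerivAt (fun x : ℝ => Real.exp (-x ^ 2 / 2)) (Real.exp (-x ^ 2 / 2) * -x) x := by
  refine ((((hasDerivAt_id x).pow 2).neg).div_const 2).exp.congr_deriv ?_
  simp
  ring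

/-- Supplies the decay of all derivatives needed for `gaussS` to be a Schwartz function. -/
theorem iteratedDeriv_gaussian (n : ℕ) : ∃ p : ℂ[X],
    iteratedDeriv n (fun x : ℝ => (Real.exp (-x ^ 2 / 2) : ℂ)) =
      fun x : ℝ => p.eval (x : ℂ) * (Real.exp (-x ^ 2 / 2) : ℂ) := by
  induction n with
  | zero => exact ⟨1, by simp⟩
  | succ n ih =>
    obtain ⟨p, hp⟩ := ih
    refine ⟨derivative p - X * p, ?_⟩
    rw [iteratedDeriv_succ, hp]
    funext x
    have h1 := hasDerivAt_gaussian x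
    have h2 := ((p.hasDerivAt (x : ℂ)).comp_ofReal).mul h1.ofReal_comp
    refine h2.deriv.trans ?_
    rw [eval_sub, eval_mul, eval_X]
    push_cast
    ring

/-- The Gaussian `φ₀` for `ħ = 1`. -/
def gaussS : SchwartzMap ℝ ℂ :=
  ((Real.pi ^ (-(1 / 4) : ℝ) : ℝ) : ℂ) •
  { toFun := fun x : ℝ => (Real.exp (-x ^ 2 / 2) : ℂ)
    smooth' := by
      have h : ContDiff ℝ ((⊤ : ℕ∞) : WithTop ℕ∞) fun x : ℝ => Real.exp (-x ^ 2 / 2) := by fun_prop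
      exact Complex.ofRealCLM.contDiff.comp h
    decay' := fun k n => by
      obtain ⟨p, hp⟩ := iteratedDeriv_gaussian n
      obtain ⟨C, hC⟩ := exists_bound_eval_mul_gaussian (X ^ k * p)
      refine ⟨C, fun x => ?_⟩
      have h := hC x
      rw [norm_iteratedFDeriv_eq_norm_iteratedDeriv, hp]
      rwa [eval_mul, eval_pow, eval_X, mul_assoc, norm_mul, norm_pow, Complex.norm_real] at h }

theorem gaussS_apply (x : ℝ) : gaussS x =
    ((Real.pi ^ (-(1 / 4) : ℝ) : ℝ) : ℂ) * (Real.exp (-x ^ 2 / 2) : ℂ) := rfl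

/-- The raising operator for `ħ = 1`. -/
def raisingS : Module.End ℂ (SchwartzMap ℝ ℂ) := ((Real.sqrt 2 : ℝ) : ℂ)⁻¹ • (mulX - derivS)

/-- The lowering operator for `ħ = 1`. -/
def loweringS : Module.End ℂ (SchwartzMap ℝ ℂ) := ((Real.sqrt 2 : ℝ) : ℂ)⁻¹ • (mulX + derivS)

/-- The normalized excited states for `ħ = 1`. -/
def hermiteS (m : ℕ) : SchwartzMap ℝ ℂ :=
  ((Real.sqrt (m.factorial : ℝ) : ℝ) : ℂ)⁻¹ • (raisingS ^ m) gaussS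

/-- The parameter is `log √ħ`. This and `dilS_hermiteS` move the dependence of the states on `ħ`
into a unitary that commutes with `dilGen`. -/
theorem dilS_gaussS {ħ : ℝ} (hħ : 0 < ħ) :
    (dilS (Real.log ħ / 2) gaussS : ℝ → ℂ) = groundState ħ := by
  funext x
  have hs : Real.exp (-(Real.log ħ / 2)) ^ 2 = ħ⁻¹ := by
    rw [← Real.exp_nat_mul, ← Real.exp_log hħ, ← Real.exp_neg, Real.log_exp]
    push_cast
    ring_nf
  have h1 : Real.exp (-(Real.log ħ / 2) / 2) = ħ ^ (-(1 / 4) : ℝ) := by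
    rw [Real.rpow_def_of_pos hħ]
    ring_nf
  rw [dilS_apply, gaussS_apply, groundState, h1, Real.mul_rpow Real.pi_pos.le hħ.le, mul_pow, hs]
  push_cast
  have h2 : (-((ħ : ℂ)⁻¹ * (x : ℂ) ^ 2) / 2) = -(x : ℂ) ^ 2 / (2 * ħ) := by
    have : (ħ : ℂ) ≠ 0 := by exact_mod_cast hħ.ne'
    field_simp
  rw [h2]
  ring

theorem raising_dilS {ħ : ℝ} (hħ : 0 < ħ) (u : SchwartzMap ℝ ℂ) :
    raising ħ (dilS (Real.log ħ / 2) u) = dilS (Real.log ħ / 2) (raisingS u) := by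
  funext x
  have h1 : Real.exp (-(Real.log ħ / 2)) = (Real.sqrt ħ)⁻¹ := by
    rw [Real.exp_neg, Real.sqrt_eq_rpow, Real.rpow_def_of_pos hħ]
    ring_nf
  have h2 := derivS_dilS (Real.log ħ / 2) u x
  rw [derivS_apply] at h2
  have hs : (Real.sqrt ħ : ℂ) ≠ 0 := by exact_mod_cast (Real.sqrt_pos.2 hħ).ne'
  have hs2 : (Real.sqrt 2 : ℂ) ≠ 0 := by
    exact_mod_cast (Real.sqrt_pos.2 (two_pos : (0 : ℝ) < 2)).ne'
  have hħs : (ħ : ℂ) = (Real.sqrt ħ : ℂ) ^ 2 := by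
    rw [← Complex.ofReal_pow, Real.sq_sqrt hħ.le]
  rw [raising, h2, raisingS, Real.sqrt_mul (by norm_num), dilS_apply, dilS_apply, dilS_apply, h1]
  simp only [LinearMap.smul_apply, LinearMap.sub_apply, smul_apply, sub_apply, mulX_apply,
    smul_eq_mul]
  push_cast
  generalize (derivS u) ((Real.sqrt ħ)⁻¹ * x) = a
  generalize u ((Real.sqrt ħ)⁻¹ * x) = b
  rw [hħs]
  field_simp

theorem dilS_hermiteS {ħ : ℝ} (hħ : 0 < ħ) (m : ℕ) :
    (dilS (Real.log ħ / 2) (hermiteS m) : ℝ → ℂ) = excitedState ħ m := by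
  have h : ∀ m, (raising ħ)^[m] (groundState ħ) =
      dilS (Real.log ħ / 2) ((raisingS ^ m) gaussS) := fun m => by
    induction m with
    | zero => exact (dilS_gaussS hħ).symm
    | succ m ih => rw [Function.iterate_succ_apply', ih, raising_dilS hħ, pow_succ',
        Module.End.mul_apply]
  funext x
  rw [excitedState, h, hermiteS, map_smul, smul_apply, smul_eq_mul]
  exact (div_eq_inv_mul _ _).symm

theorem dilS_dilation (β : ℝ) (u : SchwartzMap ℝ ℂ) : (dilS β u : ℝ → ℂ) = dilation β u :=
  funext (dilS_apply β u)

theorem inv_sqrt_two_mul_self : ((Real.sqrt 2 : ℝ) : ℂ)⁻¹ * ((Real.sqrt 2 : ℝ) : ℂ)⁻¹ = 1 / 2 := by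
  rw [← mul_inv, ← Complex.ofReal_mul, Real.mul_self_sqrt (by norm_num)]
  norm_num

theorem loweringS_mul_raisingS : loweringS * raisingS = raisingS * loweringS + 1 := by
  rw [loweringS, raisingS, smul_mul_smul_comm, smul_mul_smul_comm, inv_sqrt_two_mul_self]
  have h : (mulX + derivS) * (mulX - derivS) = (mulX - derivS) * (mulX + derivS) + (2 : ℂ) • 1 := by
    simp only [add_mul, mul_sub, sub_mul, mul_add, derivS_mul_mulX]
    module
  rw [h]
  module

/-- Quanta are created or removed in pairs, so only even excited states are reached from `φ₀`. -/
theorem eulerOp_eq_ladder : eulerOp = (1 / 2 : ℂ) • (loweringS * loweringS - raisingS * raisingS) := by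
  rw [loweringS, raisingS, smul_mul_smul_comm, smul_mul_smul_comm, inv_sqrt_two_mul_self, eulerOp]
  simp only [add_mul, mul_sub, sub_mul, mul_add, derivS_mul_mulX]
  module

theorem loweringS_gaussS : loweringS gaussS = 0 := by
  ext x
  have h1 := hasDerivAt_gaussian x
  have h2 : derivS gaussS x = -x * gaussS x := by
    refine (h1.ofReal_comp.const_mul ((Real.pi ^ (-(1 / 4) : ℝ) : ℝ) : ℂ)).deriv.trans ?_
    rw [gaussS_apply]
    push_cast
    ring
  rw [loweringS, LinearMap.smul_apply, smul_apply, LinearMap.add_apply, add_apply, mulX_apply, h2]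
  simp

theorem loweringS_raisingS_pow (m : ℕ) :
    loweringS ((raisingS ^ m) gaussS) = (m : ℂ) • (raisingS ^ (m - 1)) gaussS := by
  induction m with
  | zero => simp [loweringS_gaussS]
  | succ m ih =>
    rw [pow_succ', Module.End.mul_apply, ← Module.End.mul_apply, loweringS_mul_raisingS,
      LinearMap.add_apply, Module.End.mul_apply, ih, map_smul, Nat.add_sub_cancel]
    rcases m with _ | m
    · simp
    · rw [← Module.End.mul_apply, Nat.add_sub_cancel, ← pow_succ']
      simp only [Module.End.one_apply]
      push_cast
      module

theorem dilGen_raisingS_pow (m : ℕ) : dilGen ((raisingS ^ (2 * m)) gaussS) =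
    (-Complex.I) • (((m : ℂ) * (2 * m - 1)) • (raisingS ^ (2 * (m - 1))) gaussS
      - (1 / 2 : ℂ) • (raisingS ^ (2 * (m + 1))) gaussS) := by
  rw [dilGen, eulerOp_eq_ladder]
  simp only [LinearMap.smul_apply, LinearMap.sub_apply, Module.End.mul_apply,
    loweringS_raisingS_pow, map_smul]
  rw [← Module.End.mul_apply, ← Module.End.mul_apply, mul_assoc raisingS, ← pow_succ',
    ← pow_succ']
  congr 1
  rcases m with _ | m
  · simp
  · rw [show 2 * (m + 1) - 1 - 1 = 2 * (m + 1 - 1) by omega,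
      show 2 * (m + 1) - 1 = 2 * m + 1 by omega, show 2 * (m + 1) + 1 + 1 = 2 * (m + 1 + 1) by ring]
    push_cast
    module

/-- The operator `dilGen` in the basis of the even excited states (not normalized). -/
def jacobiOp : Module.End ℂ ℂ[X] :=
  (-Complex.I) • ((2 : ℂ) • (LinearMap.mulLeft ℂ X * derivative * derivative) + derivative
    - (1 / 2 : ℂ) • LinearMap.mulLeft ℂ X)

theorem jacobiOp_apply (f : ℂ[X]) : jacobiOp f = (-Complex.I) •
    ((2 : ℂ) • (X * derivative (derivative f)) + derivative f - (1 / 2 : ℂ) • (X * f)) := rfl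

/-- The linear map sending `X^m` to `(a*)^{2m} φ₀`. -/
def evenState : ℂ[X] →ₗ[ℂ] SchwartzMap ℝ ℂ :=
  Polynomial.lsum fun m => LinearMap.toSpanSingleton ℂ _ ((raisingS ^ (2 * m)) gaussS)

theorem evenState_monomial (m : ℕ) (a : ℂ) :
    evenState (monomial m a) = a • (raisingS ^ (2 * m)) gaussS := by
  simp [evenState, Polynomial.sum_monomial_index]

theorem dilGen_evenState (f : ℂ[X]) : dilGen (evenState f) = evenState (jacobiOp f) := by
  induction f using Polynomial.induction_on' with
  | add p q hp hq => simp only [map_add, hp, hq]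
  | monomial m a =>
    rw [evenState_monomial, map_smul, dilGen_raisingS_pow, jacobiOp_apply]
    rcases m with _ | m
    · rw [show derivative (monomial 0 a) = 0 by simp, X_mul_monomial]
      simp only [map_zero, mul_zero, smul_zero, add_zero, zero_sub, map_smul, map_neg,
        evenState_monomial, Nat.cast_zero, zero_mul, zero_smul]
      module
    · simp only [derivative_monomial, X_mul_monomial, map_smul, map_sub, map_add,
        evenState_monomial]
      rcases m with _ | m
      · simp
        module
      · simp only [Nat.add_sub_cancel]
        push_cast
        module

theorem coeff_jacobiOp_eq_zero {f : ℂ[X]} {k : ℕ} (hf : ∀ n, k < n → f.coeff n = 0) (n : ℕ)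
    (hn : k + 1 < n) : (jacobiOp f).coeff n = 0 := by
  obtain ⟨n, rfl⟩ := Nat.exists_eq_succ_of_ne_zero (show n ≠ 0 by omega)
  rw [jacobiOp_apply]
  simp only [Nat.succ_eq_add_one, coeff_smul, coeff_sub, coeff_add, coeff_X_mul, coeff_derivative]
  rw [hf (n + 1 + 1) (by omega), hf n (by omega)]
  simp

theorem coeff_jacobiOp_pow_eq_zero (s n : ℕ) (hn : s < n) :
    ((jacobiOp ^ s) (1 : ℂ[X])).coeff n = 0 := by
  induction s generalizing n with
  | zero => rw [pow_zero, Module.End.one_apply, coeff_one, if_neg (by omega)]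
  | succ s ih =>
    rw [pow_succ', Module.End.mul_apply]
    exact coeff_jacobiOp_eq_zero ih n hn

theorem dilGen_pow_gaussS (s : ℕ) : (dilGen ^ s) gaussS = evenState ((jacobiOp ^ s) 1) := by
  induction s with
  | zero =>
    rw [pow_zero, pow_zero, Module.End.one_apply, Module.End.one_apply, ← monomial_zero_one,
      evenState_monomial]
    simp
  | succ s ih =>
    rw [pow_succ', Module.End.mul_apply, ih, dilGen_evenState, pow_succ' jacobiOp,
      Module.End.mul_apply]

theorem hermiteS_zero : hermiteS 0 = gaussS := by
  simp [hermiteS]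

/-- On the even states `dilGen` acts as `jacobiOp`, which raises the degree by at most one; hence `m
≤ s`. It changes the index `m` by exactly one at each step, which is why `κ 2 1` vanishes. -/
theorem exists_dilGen_pow_expansion : ∃ κ : ℕ → ℕ → ℂ, (∀ s m, s < m → κ s m = 0) ∧ κ 2 1 = 0 ∧
    ∀ s n, s ≤ n → (dilGen ^ s) (hermiteS 0) =
      ∑ m ∈ Finset.range (n + 1), κ s m • hermiteS (2 * m) := by
  -- The square root of `(2m)!` converts `(a*)^{2m}φ₀` into normalized states.
  refine ⟨fun s m => ((jacobiOp ^ s) 1).coeff m * (Real.sqrt ((2 * m).factorial : ℝ) : ℂ),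
    fun s m h => ?_, ?_, fun s n hsn => ?_⟩
  · exact mul_eq_zero_of_left (coeff_jacobiOp_pow_eq_zero s m h) _
  · simp only [sq, Module.End.mul_apply, jacobiOp_apply]
    simp [coeff_X, coeff_one]
  · rw [hermiteS_zero, dilGen_pow_gaussS]
    set f := (jacobiOp ^ s) (1 : ℂ[X]) with hf
    have h1 : f = ∑ m ∈ Finset.range (n + 1), monomial m (f.coeff m) := by
      refine as_sum_range' f (n + 1) ?_
      rw [Nat.lt_succ_iff]
      refine (natDegree_le_iff_coeff_eq_zero.2 fun m hm => coeff_jacobiOp_pow_eq_zero s m hm).trans hsn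
    conv_lhs => rw [h1, map_sum]
    refine Finset.sum_congr rfl fun m _ => ?_
    have h2 : ((Real.sqrt ((2 * m).factorial : ℝ) : ℝ) : ℂ) ≠ 0 := by
      have : 0 < Real.sqrt ((2 * m).factorial : ℝ) :=
        Real.sqrt_pos.2 (by exact_mod_cast (2 * m).factorial_pos)
      exact_mod_cast this.ne'
    rw [evenState_monomial, hermiteS, smul_smul, mul_assoc, mul_inv_cancel₀ h2, mul_one]

end NormalFormPropagation

end

noncomputable section

namespace NormalFormPropagation

open Filter Topology Polynomial

/-! ### Duhamel estimate and Taylor expansion of the propagator -/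

/-- A product rule for a group that is only strongly continuous. Splitting `ψ r = (ψ r - ψ s) + ψ
s`, the first part uses isometry and strong continuity, the second the generator at `ψ s`; `U (-s)`
is factored out to bring the latter to time `0`. -/
theorem IsSchrodingerGroup.hasDerivAt_neg_apply {ħ : ℝ} {a : ℝ → ℝ → ℂ} {U : ℝ → L2 ≃ₗᵢ[ℂ] L2}
    (hU : IsSchrodingerGroup ħ a U) {ψ : ℝ → L2} {ψ' g : L2} {s : ℝ} (hψ : HasDerivAt ψ ψ' s)
    (hg : (ψ s, g) ∈ closure (weylGraph ħ a)) :
    HasDerivAt (fun r => U (-r) (ψ r)) (U (-s) (ψ' + (Complex.I / (ħ : ℂ)) • g)) s := by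
  have hsub : HasDerivAt (fun r : ℝ => s - r) (-1) s := by
    simpa using (hasDerivAt_id s).const_sub s
  have h1 : HasDerivAt (fun r => U (s - r) (ψ s)) ((Complex.I / (ħ : ℂ)) • g) s := by
    have h2 := (hU.generator _ _).1 hg
    rw [← sub_self s] at h2
    have h3 := h2.scomp s hsub
    rw [neg_one_smul, neg_smul, neg_neg] at h3
    exact h3
  have h2 : HasDerivAt (fun r => U (s - r) (ψ r - ψ s)) ψ' s := by
    rw [hasDerivAt_iff_tendsto_slope] at hψ ⊢
    have h3 : ∀ r, slope (fun r => U (s - r) (ψ r - ψ s)) s r = U (s - r) (slope ψ s r) := fun r => by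
      rw [slope_def_module, slope_def_module, sub_self (ψ s), _root_.map_zero, sub_zero]
      exact (((U (s - r)).toContinuousLinearEquiv.toContinuousLinearMap).map_smul_of_tower _ _).symm
    simp only [funext h3]
    have h4 : Tendsto (fun r => U (s - r) ψ') (𝓝[≠] s) (𝓝 ψ') := by
      have h5 : Continuous fun r : ℝ => U (s - r) ψ' :=
        (hU.continuous ψ').comp (continuous_const.sub continuous_id)
      have h6 := h5.tendsto s
      simp only [sub_self, hU.map_zero] at h6
      exact h6.mono_left nhdsWithin_le_nhds
    have h7 : Tendsto (fun r => U (s - r) (slope ψ s r - ψ')) (𝓝[≠] s) (𝓝 0) := by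
      rw [tendsto_zero_iff_norm_tendsto_zero]
      simp only [LinearIsometryEquiv.norm_map]
      simpa using (hψ.sub_const ψ').norm
    have h8 := h7.add h4
    rw [zero_add] at h8
    refine h8.congr fun r => ?_
    rw [← _root_.map_add, sub_add_cancel]
  have h3 := h2.add h1
  have h4 := ((U (-s)).toContinuousLinearEquiv.toContinuousLinearMap.restrictScalars
    ℝ).hasFDerivAt.comp_hasDerivAt s h3
  refine h4.congr_of_eventuallyEq (Eventually.of_forall fun r => ?_)
  change U (-r) (ψ r) = U (-s) (U (s - r) (ψ r - ψ s) + U (s - r) (ψ s))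
  rw [← _root_.map_add, sub_add_cancel, ← hU.map_add]
  congr 2
  ring

/-- Duhamel's principle: the derivative of `U (-s) (ψ s)` is the isometric image of the defect of
`ψ` in the Schrödinger equation. -/
theorem IsSchrodingerGroup.norm_sub_le {ħ : ℝ} {a : ℝ → ℝ → ℂ} {U : ℝ → L2 ≃ₗᵢ[ℂ] L2}
    (hU : IsSchrodingerGroup ħ a U) {ψ ψ' g : ℝ → L2} (hψ : ∀ s, HasDerivAt ψ (ψ' s) s)
    (hg : ∀ s, (ψ s, g s) ∈ closure (weylGraph ħ a)) {t M : ℝ}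
    (hM : ∀ s, |s| ≤ |t| → ‖ψ' s + (Complex.I / (ħ : ℂ)) • g s‖ ≤ M) :
    ‖U t (ψ 0) - ψ t‖ ≤ M * |t| := by
  have hcv : Convex ℝ (Set.Icc (-|t|) |t|) := convex_Icc _ _
  have h := hcv.norm_image_sub_le_of_norm_hasDerivWithin_le (𝕜 := ℝ) (C := M)
    (fun s _ => (hU.hasDerivAt_neg_apply (hψ s) (hg s)).hasDerivWithinAt)
    (fun s hs => by rw [LinearIsometryEquiv.norm_map]; exact hM s (abs_le.2 hs))
    (x := 0) (y := t) (by simp) ⟨neg_abs_le t, le_abs_self t⟩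
  rw [neg_zero, hU.map_zero, sub_zero, Real.norm_eq_abs, ← (U t).norm_map, map_sub, ← hU.map_add,
    add_neg_cancel, hU.map_zero, norm_sub_rev] at h
  exact h

/-- The Taylor polynomial of order `l` in `t` of `exp(-itρ(dilGen)) w`, transported by the
dilation of parameter `t b`. -/
def taylorState (ρ : ℂ[X]) (b : ℝ) (w : SchwartzMap ℝ ℂ) (l : ℕ) (t : ℝ) : SchwartzMap ℝ ℂ :=
  ∑ j ∈ Finset.range (l + 1),
    ((-Complex.I * t) ^ j / (j.factorial : ℂ)) • dilS (t * b) (aeval dilGen (ρ ^ j) w)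

theorem hasDerivAt_schwartzToL2_dilS_mul (w : SchwartzMap ℝ ℂ) (b t : ℝ) :
    HasDerivAt (fun t : ℝ => schwartzToL2 (dilS (t * b) w))
      ((-Complex.I * b) • schwartzToL2 (dilGen (dilS (t * b) w))) t := by
  have h1 : HasDerivAt (fun t : ℝ => t * b) b t := by simpa using (hasDerivAt_id t).mul_const b
  have h2 := (hasDerivAt_dilS w (t * b)).scomp t h1
  refine h2.congr_deriv ?_
  have h3 : b • -schwartzToL2 (dilS (t * b) (eulerOp w)) =
      (b : ℂ) • -schwartzToL2 (dilS (t * b) (eulerOp w)) :=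
    (Complex.coe_smul b (-schwartzToL2 (dilS (t * b) (eulerOp w)))).symm
  rw [h3, ← eulerOp_dilS, dilGen, LinearMap.smul_apply, map_smul, smul_smul, smul_neg, ← neg_smul]
  congr 1
  linear_combination (-(b : ℂ)) * Complex.I_mul_I

/-- The sum telescopes: differentiating `t^j/j!` cancels the `ρ`-part of the generator on the term
of index `j - 1`, and differentiating the dilation gives the linear part. Only the `ρ`-part on the
last term remains. -/
theorem hasDerivAt_taylorState (ρ : ℂ[X]) (b : ℝ) (w : SchwartzMap ℝ ℂ) (l : ℕ) (t : ℝ) :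
    HasDerivAt (fun t => schwartzToL2 (taylorState ρ b w l t))
      ((-Complex.I) • schwartzToL2 (aeval dilGen (C (b : ℂ) * X + ρ) (taylorState ρ b w l t)) +
        (Complex.I * ((-Complex.I * t) ^ l / (l.factorial : ℂ))) •
          schwartzToL2 (dilS (t * b) (aeval dilGen (ρ ^ (l + 1)) w))) t := by
  have hgen : ∀ j, aeval dilGen (C (b : ℂ) * X + ρ) (dilS (t * b) (aeval dilGen (ρ ^ j) w)) =
      (b : ℂ) • dilGen (dilS (t * b) (aeval dilGen (ρ ^ j) w)) +
        dilS (t * b) (aeval dilGen (ρ ^ (j + 1)) w) := fun j => by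
    rw [map_add, map_mul, aeval_C, aeval_X, LinearMap.add_apply, Module.End.mul_apply,
      Module.algebraMap_end_apply, aeval_dilGen_dilS, pow_succ' ρ, map_mul, Module.End.mul_apply]
  induction l with
  | zero =>
    simp only [taylorState, zero_add, Finset.sum_range_one, pow_zero, Nat.factorial_zero,
      Nat.cast_one, div_one, one_smul, mul_one]
    refine (hasDerivAt_schwartzToL2_dilS_mul _ b t).congr_deriv ?_
    have h := hgen 0
    rw [pow_zero, zero_add] at h
    rw [h, map_add, map_smul, smul_add, smul_smul]
    module
  | succ l ih =>
    have hc : HasDerivAt (fun t : ℝ => (-Complex.I * t) ^ (l + 1) / ((l + 1).factorial : ℂ))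
        (-Complex.I * ((-Complex.I * t) ^ l / (l.factorial : ℂ))) t := by
      have h1 : HasDerivAt (fun t : ℝ => -Complex.I * (t : ℂ)) (-Complex.I) t := by
        simpa using ((hasDerivAt_id t).ofReal_comp).const_mul (-Complex.I)
      refine ((h1.pow (l + 1)).div_const _).congr_deriv ?_
      have h2 : (l.factorial : ℂ) ≠ 0 := by exact_mod_cast l.factorial_ne_zero
      have h3 : (l : ℂ) + 1 ≠ 0 := by exact_mod_cast l.succ_ne_zero
      rw [Nat.factorial_succ, Nat.add_sub_cancel]
      push_cast
      field_simp
    have hterm := hc.smul (hasDerivAt_schwartzToL2_dilS_mul (aeval dilGen (ρ ^ (l + 1)) w) b t)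
    have hsucc : ∀ t, taylorState ρ b w (l + 1) t = taylorState ρ b w l t +
        ((-Complex.I * t) ^ (l + 1) / ((l + 1).factorial : ℂ)) •
          dilS (t * b) (aeval dilGen (ρ ^ (l + 1)) w) := fun t => Finset.sum_range_succ _ _
    have hsum := ih.add hterm
    simp only [hsucc, map_add, map_smul]
    refine hsum.congr_deriv ?_
    rw [← map_add, hgen, map_add]
    simp only [map_add, map_smul, smul_add, smul_smul]
    module

theorem taylorState_zero (ρ : ℂ[X]) (b : ℝ) (w : SchwartzMap ℝ ℂ) (l : ℕ) :
    taylorState ρ b w l 0 = w := by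
  rw [taylorState, Finset.sum_range_succ', Finset.sum_eq_zero fun j _ => by simp]
  simp [dilS_zero]

theorem polyQ_one {N : ℕ} (hN : 1 ≤ N) (q : ℕ → ℕ → ℝ) (ħ : ℝ) :
    polyQ N q ħ 1 = C (coeffQ N q ħ 1) * X + polyQ N q ħ 2 := by
  rw [polyQ, ← Finset.add_sum_Ioc_eq_sum_Icc hN, polyQ]
  simp [weylPoly]
  rfl

theorem norm_schrodingerGroup_sub_taylorState_le {N : ℕ} (hN : 1 ≤ N) (q : ℕ → ℕ → ℝ) {ħ : ℝ}
    (hħ : 0 < ħ) (w : SchwartzMap ℝ ℂ) (l : ℕ) (t : ℝ) :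
    ‖schrodingerGroup ħ (symbolQ N q ħ) t (schwartzToL2 w) - schwartzToL2
      (taylorState ((polyQ N q ħ 2).map Complex.ofRealHom) (coeffQ N q ħ 1) w l t)‖ ≤
      |t| ^ (l + 1) * ‖schwartzToL2
        (aeval dilGen (((polyQ N q ħ 2).map Complex.ofRealHom) ^ (l + 1)) w)‖ := by
  set ρ := (polyQ N q ħ 2).map Complex.ofRealHom with hρ
  have hU := isSchrodingerGroup_schrodingerGroup N q hħ
  have hne : (ħ : ℂ) ≠ 0 := by exact_mod_cast hħ.ne'
  have hP : (polyQ N q ħ 1).map Complex.ofRealHom = C (coeffQ N q ħ 1 : ℂ) * X + ρ := by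
    rw [polyQ_one hN, Polynomial.map_add, Polynomial.map_mul, Polynomial.map_C, Polynomial.map_X]
    rfl
  have hg : ∀ s, (schwartzToL2 (taylorState ρ (coeffQ N q ħ 1) w l s), (ħ : ℂ) • schwartzToL2
      (aeval dilGen (C (coeffQ N q ħ 1 : ℂ) * X + ρ) (taylorState ρ (coeffQ N q ħ 1) w l s))) ∈
      closure (weylGraph ħ (symbolQ N q ħ)) := fun s => by
    refine subset_closure ?_
    rw [weylGraph_symbolQ N q hħ]
    refine mem_polyGraph.2 ⟨taylorState ρ (coeffQ N q ħ 1) w l s, rfl, ?_⟩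
    rw [hP, smul_smul, neg_mul, div_mul_cancel₀ _ hne]
  have h := hU.norm_sub_le (fun s => hasDerivAt_taylorState ρ (coeffQ N q ħ 1) w l s) hg (t := t)
    (M := |t| ^ l * ‖schwartzToL2 (aeval dilGen (ρ ^ (l + 1)) w)‖) fun s hs => by
      rw [smul_smul, div_mul_cancel₀ _ hne, neg_smul, neg_add_eq_sub, sub_add_cancel, norm_smul,
        norm_dilS, norm_mul, Complex.norm_I, one_mul, norm_div, norm_pow, norm_mul, norm_neg,
        Complex.norm_I, one_mul, Complex.norm_real, Complex.norm_natCast, Real.norm_eq_abs]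
      refine mul_le_mul_of_nonneg_right ?_ (norm_nonneg _)
      refine (div_le_self (by positivity) ?_).trans (pow_le_pow_left₀ (abs_nonneg s) hs l)
      exact_mod_cast l.factorial_pos
  rw [taylorState_zero] at h
  refine h.trans (le_of_eq (by ring))

end NormalFormPropagation

end

noncomputable section

namespace NormalFormPropagation

open Filter Topology Polynomial

/-! ### Coefficients of the expansion -/

theorem natDegree_weylPoly_le (α : ℕ) : (weylPoly α).natDegree ≤ α := by
  induction α using Nat.twoStepInduction with
  | zero => simp [weylPoly]
  | one => simp [weylPoly]
  | more n ih0 ih1 =>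
    rw [weylPoly]
    have h1 : (X * weylPoly (n + 1)).natDegree ≤ n + 2 := by
      have h := natDegree_mul_le (p := X) (q := weylPoly (n + 1))
      rw [natDegree_X] at h
      omega
    have h2 : (C (((n : ℝ) + 1) ^ 2 / 4) * weylPoly n).natDegree ≤ n + 2 :=
      (natDegree_C_mul_le _ _).trans (by omega)
    exact (natDegree_sub_le_of_le h1 h2).trans (max_self _).le

/-- With `κ 2 1 = 0`, this is the source of the exceptional order `2` in `hbarOrder 1`. -/
theorem coeff_weylPoly_two : (weylPoly 2).coeff 1 = 0 := by
  simp [weylPoly]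

theorem coeff_polyQ (N : ℕ) (q : ℕ → ℕ → ℝ) (ħ : ℝ) (a s : ℕ) : (polyQ N q ħ a).coeff s =
    ∑ α ∈ Finset.Icc a N, coeffQ N q ħ α * ħ ^ (α - 1) * (weylPoly α).coeff s := by
  simp only [polyQ, finsetSum_coeff, coeff_C_mul]

theorem natDegree_polyQ_le (N : ℕ) (q : ℕ → ℕ → ℝ) (ħ : ℝ) (a : ℕ) :
    (polyQ N q ħ a).natDegree ≤ N := by
  refine natDegree_sum_le_of_forall_le _ _ fun α hα => ?_
  exact (natDegree_C_mul_le _ _).trans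
    ((natDegree_weylPoly_le α).trans (Finset.mem_Icc.1 hα).2)

theorem abs_coeffQ_le {N : ℕ} {K : ℝ} {q : ℕ → ℕ → ℝ} {α : ℕ} (hq : ∀ i ≤ N, |q α i| ≤ K) {ħ : ℝ}
    (h0 : 0 < ħ) (h1 : ħ ≤ 1) : |coeffQ N q ħ α| ≤ (N + 1) * |K| := by
  refine (Finset.abs_sum_le_sum_abs _ _).trans ((Finset.sum_le_card_nsmul _ _ |K| fun i hi => ?_).trans
    (le_of_eq (by simp)))
  rw [abs_mul, abs_of_pos (pow_pos h0 i)]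
  have h2 := (hq i (Nat.lt_succ_iff.1 (Finset.mem_range.1 hi))).trans (le_abs_self K)
  exact (mul_le_of_le_one_left (abs_nonneg _) (pow_le_one₀ h0.le h1)).trans h2

/-- The polynomial `p_α` enters with weight `ħ^{α-1}` and reaches degree `s` only if `α ≥ s`, while
`α ≥ 2` throughout. In degree one `α = 2` drops out, leaving `α ≥ 3`. -/
theorem exists_coeff_polyQ_bound (N : ℕ) (K : ℝ) : ∃ A : ℝ, 0 ≤ A ∧ ∀ q : ℕ → ℕ → ℝ,
    (∀ α i : ℕ, 2 ≤ α → α ≤ N → i ≤ N → |q α i| ≤ K) → ∀ ħ : ℝ, 0 < ħ → ħ ≤ 1 →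
      (∀ s, |(polyQ N q ħ 2).coeff s| ≤ A * ħ ^ max 1 (s - 1)) ∧
        |(polyQ N q ħ 2).coeff 1| ≤ A * ħ ^ 2 := by
  let B : ℕ → ℝ := fun α => ∑ s ∈ Finset.range (α + 1), |(weylPoly α).coeff s|
  have hB : ∀ α s, |(weylPoly α).coeff s| ≤ B α := fun α s => by
    by_cases hs : s < α + 1
    · exact Finset.single_le_sum (f := fun s => |(weylPoly α).coeff s|)
        (fun _ _ => abs_nonneg _) (Finset.mem_range.2 hs)
    · have h1 := natDegree_weylPoly_le α
      rw [coeff_eq_zero_of_natDegree_lt (by omega), abs_zero]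
      exact Finset.sum_nonneg fun _ _ => abs_nonneg _
  have hB0 : ∀ α, 0 ≤ B α := fun α => (abs_nonneg _).trans (hB α 0)
  refine ⟨∑ α ∈ Finset.Icc 2 N, (N + 1) * |K| * B α,
    Finset.sum_nonneg fun α _ => mul_nonneg (by positivity) (hB0 α), fun q hq ħ h0 h1 => ?_⟩
  have key : ∀ e s, (∀ α ∈ Finset.Icc 2 N, (weylPoly α).coeff s ≠ 0 → e ≤ α - 1) →
      |(polyQ N q ħ 2).coeff s| ≤ (∑ α ∈ Finset.Icc 2 N, (N + 1) * |K| * B α) * ħ ^ e :=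
    fun e s he => by
      rw [coeff_polyQ, Finset.sum_mul]
      refine (Finset.abs_sum_le_sum_abs _ _).trans (Finset.sum_le_sum fun α hα => ?_)
      by_cases hz : (weylPoly α).coeff s = 0
      · rw [hz, mul_zero, abs_zero]
        exact mul_nonneg (mul_nonneg (by positivity) (hB0 α)) (by positivity)
      · have hα' := Finset.mem_Icc.1 hα
        have h2 := abs_coeffQ_le (fun i hi => hq α i hα'.1 hα'.2 hi) h0 h1
        have h3 : ħ ^ (α - 1) ≤ ħ ^ e := pow_le_pow_of_le_one h0.le h1 (he α hα hz)
        rw [abs_mul, abs_mul, abs_of_pos (pow_pos h0 _)]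
        calc |coeffQ N q ħ α| * ħ ^ (α - 1) * |(weylPoly α).coeff s|
            ≤ (N + 1) * |K| * ħ ^ e * B α := by
              have := hB α s
              gcongr
          _ = _ := by ring
  refine ⟨fun s => key _ s fun α hα hz => ?_, key 2 1 fun α hα hz => ?_⟩
  · have h2 := le_natDegree_of_ne_zero hz
    have h3 := natDegree_weylPoly_le α
    have h4 := (Finset.mem_Icc.1 hα).1
    omega
  · have h4 := (Finset.mem_Icc.1 hα).1
    have h5 : α ≠ 2 := fun h => hz (h ▸ coeff_weylPoly_two)
    omega

theorem exists_coeff_pow_bound (N : ℕ) {A : ℝ} (hA : 0 ≤ A) (j : ℕ) :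
    ∃ D : ℝ, 0 ≤ D ∧ ∀ (ρ : ℝ[X]) (ħ : ℝ), 0 < ħ → ħ ≤ 1 → ρ.natDegree ≤ N →
      (∀ s, |ρ.coeff s| ≤ A * ħ ^ max 1 (s - 1)) →
      ∀ s, |(ρ ^ j).coeff s| ≤ D * ħ ^ max j (s - j) := by
  induction j with
  | zero =>
    refine ⟨1, zero_le_one, fun ρ ħ h0 h1 _ _ s => ?_⟩
    rw [pow_zero, coeff_one]
    split_ifs with h
    · simp [h]
    · rw [abs_zero]; positivity
  | succ j ih =>
    obtain ⟨D, hD0, hD⟩ := ih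
    -- At most `N(j+1) + 1` pairs contribute to the convolution, since the coefficient vanishes
    -- beyond degree `N(j+1)`.
    refine ⟨(N * (j + 1) + 1 : ℕ) * (A * D), by positivity, fun ρ ħ h0 h1 hdeg hρ s => ?_⟩
    by_cases hs : N * (j + 1) < s
    · have h2 : (ρ ^ (j + 1)).natDegree ≤ (j + 1) * N :=
        natDegree_pow_le.trans (Nat.mul_le_mul_left _ hdeg)
      rw [mul_comm] at h2
      rw [coeff_eq_zero_of_natDegree_lt (h2.trans_lt hs), abs_zero]
      positivity
    · rw [pow_succ', coeff_mul]
      refine (Finset.abs_sum_le_sum_abs _ _).trans ((Finset.sum_le_card_nsmul _ _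
        (A * D * ħ ^ max (j + 1) (s - (j + 1))) fun p hp => ?_).trans ?_)
      · have hp' := Finset.HasAntidiagonal.mem_antidiagonal.1 hp
        rw [abs_mul]
        calc |ρ.coeff p.1| * |(ρ ^ j).coeff p.2|
            ≤ (A * ħ ^ max 1 (p.1 - 1)) * (D * ħ ^ max j (p.2 - j)) :=
              mul_le_mul (hρ _) (hD ρ ħ h0 h1 hdeg hρ _) (abs_nonneg _) (by positivity)
          _ = A * D * ħ ^ (max 1 (p.1 - 1) + max j (p.2 - j)) := by rw [pow_add]; ring
          _ ≤ A * D * ħ ^ max (j + 1) (s - (j + 1)) := by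
              refine mul_le_mul_of_nonneg_left (pow_le_pow_of_le_one h0.le h1 ?_) (by positivity)
              omega
      · have h2 : ((s + 1 : ℕ) : ℝ) ≤ (N * (j + 1) + 1 : ℕ) := by
          exact_mod_cast (by omega : s + 1 ≤ N * (j + 1) + 1)
        have h3 : 0 ≤ A * D * ħ ^ max (j + 1) (s - (j + 1)) := by positivity
        rw [Finset.Nat.card_antidiagonal, nsmul_eq_mul]
        exact (mul_le_mul_of_nonneg_right h2 h3).trans (le_of_eq (by ring))

/-- `polyQ N q ħ 2` with `ħ` as an indeterminate. -/
def polyQTH (N : ℕ) (q : ℕ → ℕ → ℝ) : ℂ[X][X] :=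
  ∑ α ∈ Finset.Icc 2 N, C ((∑ i ∈ Finset.range (N + 1), X ^ i * C (q α i : ℂ)) * X ^ (α - 1)) *
    (weylPoly α).map ((C : ℂ →+* ℂ[X]).comp Complex.ofRealHom)

theorem map_polyQTH (N : ℕ) (q : ℕ → ℕ → ℝ) (ħ : ℝ) :
    (polyQTH N q).map (evalRingHom (ħ : ℂ)) = (polyQ N q ħ 2).map Complex.ofRealHom := by
  have h : (evalRingHom (ħ : ℂ)).comp ((C : ℂ →+* ℂ[X]).comp Complex.ofRealHom) =
      Complex.ofRealHom := by
    ext x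
    simp
  simp only [polyQTH, polyQ, Polynomial.map_sum, Polynomial.map_mul, Polynomial.map_C,
    Polynomial.map_map, h]
  refine Finset.sum_congr rfl fun α _ => ?_
  congr 2
  simp only [coe_evalRingHom, eval_mul, eval_finsetSum, eval_pow, eval_X, eval_C, coeffQ,
    Complex.ofRealHom_eq_coe]
  push_cast
  rfl

/-- The polynomial coefficient of `φ_{2m}` in the expansion of order `l`, where the array `κ`
expands the powers of `dilGen` on `φ₀` in excited states. -/
def expansionCoeff (κ : ℕ → ℕ → ℂ) (N : ℕ) (q : ℕ → ℕ → ℝ) (l m : ℕ) : ℂ[X][X] :=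
  ∑ j ∈ Finset.range l, monomial (j + 1) (C ((-Complex.I) ^ (j + 1) / ((j + 1).factorial : ℂ)) *
    ∑ s ∈ Finset.range (N * l + 1), (polyQTH N q ^ (j + 1)).coeff s * C (κ s m))

/-- The coefficient of `φ_{2m}` in `ρ(dilGen)^j φ₀`. -/
def stateCoeff (κ : ℕ → ℕ → ℂ) (n : ℕ) (ρ : ℝ[X]) (j m : ℕ) : ℂ :=
  ∑ s ∈ Finset.range (n + 1), ((ρ ^ j).coeff s : ℂ) * κ s m

theorem evalTH_expansionCoeff (κ : ℕ → ℕ → ℂ) (N : ℕ) (q : ℕ → ℕ → ℝ) (l m : ℕ) (t ħ : ℝ) :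
    evalTH (expansionCoeff κ N q l m) t ħ = ∑ j ∈ Finset.range l,
      (-Complex.I * t) ^ (j + 1) / ((j + 1).factorial : ℂ) *
        stateCoeff κ (N * l) (polyQ N q ħ 2) (j + 1) m := by
  have h : ∀ j s, ((polyQTH N q ^ j).coeff s).eval (ħ : ℂ) = ((polyQ N q ħ 2 ^ j).coeff s : ℂ) :=
    fun j s => by
      rw [← coe_evalRingHom, ← coeff_map, Polynomial.map_pow, map_polyQTH, ← Polynomial.map_pow,
        coeff_map]
      rfl
  simp only [evalTH, expansionCoeff, evalEval, eval_finsetSum, eval_monomial, eval_mul, eval_pow,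
    eval_C, h, stateCoeff, mul_pow]
  refine Finset.sum_congr rfl fun j _ => ?_
  ring

theorem expansionCoeff_eq_zero {κ : ℕ → ℕ → ℂ} (hκ : ∀ s m, s < m → κ s m = 0) {N : ℕ}
    (q : ℕ → ℕ → ℝ) {l m : ℕ} (hm : N * l < m) : expansionCoeff κ N q l m = 0 := by
  refine Finset.sum_eq_zero fun j _ => ?_
  rw [Finset.sum_eq_zero fun s hs => ?_, mul_zero, monomial_zero_right]
  rw [hκ s m (by have := Finset.mem_range.1 hs; omega), C_0, mul_zero]

theorem natDegree_expansionCoeff_le (κ : ℕ → ℕ → ℂ) (N : ℕ) (q : ℕ → ℕ → ℝ) (l m : ℕ) :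
    (expansionCoeff κ N q l m).natDegree ≤ l :=
  natDegree_sum_le_of_forall_le _ _ fun _ hj =>
    (natDegree_monomial_le _).trans (Finset.mem_range.1 hj)

theorem norm_stateCoeff_le {κ : ℕ → ℕ → ℂ} (hκ : ∀ s m, s < m → κ s m = 0) {n : ℕ} {ρ : ℝ[X]}
    {j m : ℕ} {D : ℝ} (hD : 0 ≤ D) (h : ∀ s, κ s m ≠ 0 → |(ρ ^ j).coeff s| ≤ D) :
    ‖stateCoeff κ n ρ j m‖ ≤
      D * ∑ s ∈ Finset.range (n + 1), ∑ m ∈ Finset.range (n + 1), ‖κ s m‖ := by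
  rw [stateCoeff, Finset.mul_sum]
  refine (norm_sum_le _ _).trans (Finset.sum_le_sum fun s hs => ?_)
  by_cases hz : κ s m = 0
  · rw [hz, mul_zero, norm_zero]
    exact mul_nonneg hD (Finset.sum_nonneg fun _ _ => norm_nonneg _)
  · have hm : m ∈ Finset.range (n + 1) := by
      have h1 : m ≤ s := not_lt.1 fun h => hz (hκ s m h)
      have h2 := Finset.mem_range.1 hs
      exact Finset.mem_range.2 (by omega)
    rw [norm_mul, Complex.norm_real, Real.norm_eq_abs]
    exact mul_le_mul (h s hz) (Finset.single_le_sum (f := fun m => ‖κ s m‖)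
      (fun _ _ => norm_nonneg _) hm) (norm_nonneg _) hD

theorem aeval_dilGen_hermiteS {κ : ℕ → ℕ → ℂ}
    (hκ : ∀ s n, s ≤ n → (dilGen ^ s) (hermiteS 0) =
      ∑ m ∈ Finset.range (n + 1), κ s m • hermiteS (2 * m))
    {ρ : ℝ[X]} {j n : ℕ} (hn : (ρ ^ j).natDegree ≤ n) :
    aeval dilGen ((ρ.map Complex.ofRealHom) ^ j) (hermiteS 0) =
      ∑ m ∈ Finset.range (n + 1), stateCoeff κ n ρ j m • hermiteS (2 * m) := by
  rw [← Polynomial.map_pow, aeval_eq_sum_range' (natDegree_map_le.trans_lt (Nat.lt_succ_of_le hn)),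
    LinearMap.sum_apply]
  simp only [stateCoeff, Finset.sum_smul, LinearMap.smul_apply]
  rw [Finset.sum_comm]
  refine Finset.sum_congr rfl fun s hs => ?_
  rw [hκ s n (Nat.lt_succ_iff.1 (Finset.mem_range.1 hs)), Finset.smul_sum, coeff_map]
  refine Finset.sum_congr rfl fun m _ => ?_
  rw [smul_smul]
  rfl

/-- The term `j = 0` is the dilated ground state. In the others `j ≤ l`, so `ρ^j` has degree at most
`Nl`, which bounds the index `m`. -/
theorem taylorState_eq {κ : ℕ → ℕ → ℂ}
    (hκ : ∀ s n, s ≤ n → (dilGen ^ s) (hermiteS 0) =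
      ∑ m ∈ Finset.range (n + 1), κ s m • hermiteS (2 * m))
    (N : ℕ) (q : ℕ → ℕ → ℝ) (ħ a b : ℝ) (l : ℕ) (t : ℝ) :
    taylorState ((polyQ N q ħ 2).map Complex.ofRealHom) b (dilS a (hermiteS 0)) l t =
      dilS (t * b) (dilS a (hermiteS 0)) + ∑ m ∈ Finset.range (N * l + 1),
        evalTH (expansionCoeff κ N q l m) t ħ • dilS (t * b) (dilS a (hermiteS (2 * m))) := by
  rw [taylorState, Finset.sum_range_succ', add_comm]
  congr 1
  · simp
  · simp only [evalTH_expansionCoeff, Finset.sum_smul]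
    rw [Finset.sum_comm]
    refine Finset.sum_congr rfl fun j hj => ?_
    have hdeg : (polyQ N q ħ 2 ^ (j + 1)).natDegree ≤ N * l := by
      refine natDegree_pow_le.trans ?_
      rw [mul_comm]
      exact Nat.mul_le_mul (natDegree_polyQ_le N q ħ 2) (Finset.mem_range.1 hj)
    rw [aeval_dilGen_dilS, aeval_dilGen_hermiteS hκ hdeg]
    simp only [map_sum, map_smul, Finset.smul_sum, smul_smul]

end NormalFormPropagation

end

/-! ### Uniform bounds and assembly of the expansion -/

noncomputable section

namespace NormalFormPropagation

open Filter Topology Polynomial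

theorem groundL2_eq {ħ : ℝ} (hħ : 0 < ħ) :
    groundL2 ħ hħ = schwartzToL2 (dilS (Real.log ħ / 2) (hermiteS 0)) := by
  refine Lp.ext ?_
  refine (memLp_groundState hħ).coeFn_toLp.trans ?_
  rw [← dilS_gaussS hħ, ← hermiteS_zero]
  exact ((dilS (Real.log ħ / 2) (hermiteS 0)).coeFn_toLp 2 volume).symm

theorem dilation_excitedState {ħ : ℝ} (hħ : 0 < ħ) (β : ℝ) (m : ℕ) :
    dilation β (excitedState ħ m) = dilS β (dilS (Real.log ħ / 2) (hermiteS m)) := by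
  rw [← dilS_hermiteS hħ]
  exact (dilS_dilation β _).symm

theorem dilation_groundState {ħ : ℝ} (hħ : 0 < ħ) (β : ℝ) :
    dilation β (groundState ħ) = dilS β (dilS (Real.log ħ / 2) (hermiteS 0)) := by
  rw [← dilS_gaussS hħ, hermiteS_zero]
  exact (dilS_dilation β _).symm

theorem eLpNorm_expansionError (N : ℕ) (q : ℕ → ℕ → ℝ) (c : ℕ → ℂ[X][X]) (M : ℕ) {ħ : ℝ}
    (hħ : 0 < ħ) (t : ℝ) :
    eLpNorm (expansionError N q c M ħ hħ t) 2 volume = ENNReal.ofReal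
      ‖schrodingerGroup ħ (symbolQ N q ħ) t
          (schwartzToL2 (dilS (Real.log ħ / 2) (hermiteS 0))) -
        schwartzToL2 (dilS (t * coeffQ N q ħ 1) (dilS (Real.log ħ / 2) (hermiteS 0)) +
          ∑ m ∈ Finset.range (M + 1), evalTH (c m) t ħ •
            dilS (t * coeffQ N q ħ 1) (dilS (Real.log ħ / 2) (hermiteS (2 * m))))‖ := by
  set f := schrodingerGroup ħ (symbolQ N q ħ) t
    (schwartzToL2 (dilS (Real.log ħ / 2) (hermiteS 0))) with hf
  set g := dilS (t * coeffQ N q ħ 1) (dilS (Real.log ħ / 2) (hermiteS 0)) +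
    ∑ m ∈ Finset.range (M + 1), evalTH (c m) t ħ •
      dilS (t * coeffQ N q ħ 1) (dilS (Real.log ħ / 2) (hermiteS (2 * m))) with hg
  have h : expansionError N q c M ħ hħ t =ᵐ[volume] (f - schwartzToL2 g : L2) := by
    filter_upwards [Lp.coeFn_sub f (schwartzToL2 g), g.coeFn_toLp 2 volume] with x hx1 hx2
    rw [hx1, Pi.sub_apply, SchwartzMap.toLpCLM_apply, hx2, hg, expansionError, groundL2_eq hħ, ← hf,
      dilation_groundState hħ, add_apply, sum_apply, sub_sub]
    simp only [smul_apply, smul_eq_mul, dilation_excitedState hħ]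
  rw [eLpNorm_congr_ae h, Lp.norm_def, ENNReal.ofReal_toReal (Lp.eLpNorm_ne_top _)]

/-- The larger of `j` and `m - j` is at least `m/2`, hence at least `⌊(m+1)/2⌋`. Only `m = j = 1`
falls short of the prescribed order. -/
theorem hbarOrder_le {m j : ℕ} (hj : 1 ≤ j) (h : m = 1 → j ≠ 1) :
    hbarOrder m ≤ max j (m - j) := by
  unfold hbarOrder
  split_ifs with h1 h2
  · omega
  · have := h h2
    omega
  · omega

/-- Bounds for the coefficients `stateCoeff`, uniform in `q` and `ħ`. -/
theorem exists_stateCoeff_bound {κ : ℕ → ℕ → ℂ} (hκ : ∀ s m, s < m → κ s m = 0)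
    (hκ21 : κ 2 1 = 0) (N l : ℕ) (K : ℝ) :
    ∃ E : ℝ, 0 ≤ E ∧ ∀ q : ℕ → ℕ → ℝ,
      (∀ α i : ℕ, 2 ≤ α → α ≤ N → i ≤ N → |q α i| ≤ K) → ∀ ħ : ℝ, 0 < ħ → ħ ≤ 1 →
        (∀ s, |(polyQ N q ħ 2 ^ (l + 1)).coeff s| ≤ E * ħ ^ (l + 1)) ∧
        ∀ j < l, ∀ m,
          ‖stateCoeff κ (N * l) (polyQ N q ħ 2) (j + 1) m‖ ≤ E * ħ ^ (m - (j + 1)) ∧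
          ‖stateCoeff κ (N * l) (polyQ N q ħ 2) (j + 1) m‖ ≤ E * ħ ^ hbarOrder m := by
  obtain ⟨A, hA0, hA⟩ := exists_coeff_polyQ_bound N K
  choose D hD0 hD using exists_coeff_pow_bound N hA0
  set S := ∑ s ∈ Finset.range (N * l + 1), ∑ m ∈ Finset.range (N * l + 1), ‖κ s m‖ with hS
  have hS0 : 0 ≤ S := Finset.sum_nonneg fun _ _ => Finset.sum_nonneg fun _ _ => norm_nonneg _
  set F := A + ∑ j ∈ Finset.range (l + 2), D j with hF
  have hDF : ∀ j < l + 2, D j ≤ F := fun j hj => by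
    have := Finset.single_le_sum (f := D) (fun i _ => hD0 i) (Finset.mem_range.2 hj)
    linarith
  have hF0 : 0 ≤ F := (hD0 0).trans (hDF 0 (by omega))
  have hAF : A ≤ F := le_add_of_nonneg_right (Finset.sum_nonneg fun i _ => hD0 i)
  refine ⟨F * (1 + S), by positivity, fun q hq ħ h0 h1 => ?_⟩
  obtain ⟨hρ, hρ1⟩ := hA q hq ħ h0 h1
  have hpow : ∀ j < l + 2, ∀ s e, e ≤ max j (s - j) →
      |(polyQ N q ħ 2 ^ j).coeff s| ≤ F * ħ ^ e := fun j hj s e he =>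
    (hD j _ ħ h0 h1 (natDegree_polyQ_le N q ħ 2) hρ s).trans
      (mul_le_mul (hDF j hj) (pow_le_pow_of_le_one h0.le h1 he) (by positivity) hF0)
  have hst : ∀ j m e, (∀ s, κ s m ≠ 0 → |(polyQ N q ħ 2 ^ j).coeff s| ≤ F * ħ ^ e) →
      ‖stateCoeff κ (N * l) (polyQ N q ħ 2) j m‖ ≤ F * (1 + S) * ħ ^ e := fun j m e h => by
    refine (norm_stateCoeff_le hκ (by positivity) h).trans ?_
    rw [← hS]
    have : 0 ≤ F * ħ ^ e := by positivity
    nlinarith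
  refine ⟨fun s => ?_, fun j hj m => ⟨hst _ _ _ fun s hs => ?_, hst _ _ _ fun s hs => ?_⟩⟩
  · refine (hpow (l + 1) (by omega) s (l + 1) (le_max_left _ _)).trans ?_
    gcongr
    nlinarith
  · have hms : m ≤ s := not_lt.1 fun h => hs (hκ s m h)
    exact hpow _ (by omega) s _ (by omega)
  · have hms : m ≤ s := not_lt.1 fun h => hs (hκ s m h)
    -- The exceptional case, with `ρ` to the first power: `s = 1` is covered by the `ħ²` bound on
    -- the linear coefficient, `s = 2` is excluded by `κ 2 1 = 0`, and `s ≥ 3` gives `ħ^{s-1}`.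
    by_cases hm : m = 1 ∧ j = 0
    · obtain ⟨rfl, rfl⟩ := hm
      have hs2 : s ≠ 2 := fun h => hs (h ▸ hκ21)
      change _ ≤ F * ħ ^ 2
      by_cases hs1 : s = 1
      · subst hs1
        rw [zero_add, pow_one]
        exact hρ1.trans (by gcongr)
      · exact hpow _ (by omega) s _ (by omega)
    · refine hpow _ (by omega) s _ ((hbarOrder_le (j := j + 1) (by omega) (by omega)).trans ?_)
      omega

theorem pow_succ_le_mul_max {x : ℝ} (hx : 0 ≤ x) {j l : ℕ} (hj : j ≤ l) :
    x ^ (j + 1) ≤ x * max 1 (x ^ l) := by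
  rw [pow_succ']
  refine mul_le_mul_of_nonneg_left ?_ hx
  rcases le_total x 1 with h | h
  · exact (pow_le_one₀ hx h).trans (le_max_left _ _)
  · exact (pow_le_pow_right₀ h hj).trans (le_max_right _ _)

theorem norm_evalTH_expansionCoeff_le {κ : ℕ → ℕ → ℂ} {N l m : ℕ} {q : ℕ → ℕ → ℝ} {t ħ B : ℝ}
    {T : ℝ} (hT : ∀ j < l, |t| ^ (j + 1) ≤ T)
    (h : ∀ j < l, ‖stateCoeff κ (N * l) (polyQ N q ħ 2) (j + 1) m‖ ≤ B) :
    ‖evalTH (expansionCoeff κ N q l m) t ħ‖ ≤ l * (T * B) := by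
  rw [evalTH_expansionCoeff]
  refine (norm_sum_le _ _).trans ((Finset.sum_le_card_nsmul _ _ (T * B) fun j hj => ?_).trans
    (le_of_eq (by simp)))
  have hj' := Finset.mem_range.1 hj
  rw [norm_mul, norm_div, norm_pow, norm_mul, norm_neg, Complex.norm_I, one_mul, Complex.norm_real,
    Complex.norm_natCast, Real.norm_eq_abs]
  have h1 : |t| ^ (j + 1) / ((j + 1).factorial : ℝ) ≤ T :=
    (div_le_self (by positivity) (by exact_mod_cast (j + 1).factorial_pos)).trans (hT j hj')
  exact mul_le_mul h1 (h j hj') (norm_nonneg _) ((by positivity : (0 : ℝ) ≤ _).trans h1)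

/-- The full sum up to `Nl` is exactly the Taylor state, so its error is the Duhamel remainder. The
sum up to `2l` differs by a tail that is already `O(ħ^{l+1})`, but carries all powers of `t` from
`1` to `l`, whence the factor `|t| max(1, |t|^l)`. -/
theorem exists_expansion {N : ℕ} (hN : 1 ≤ N) (l : ℕ) (K : ℝ) :
    ∃ C : ℝ, 0 < C ∧ ∀ q : ℕ → ℕ → ℝ,
      (∀ α i : ℕ, 2 ≤ α → α ≤ N → i ≤ N → |q α i| ≤ K) →
      ∃ c : ℕ → ℂ[X][X], (∀ m : ℕ, N * l < m → c m = 0) ∧ (∀ m : ℕ, (c m).natDegree ≤ l) ∧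
        (∀ (m : ℕ) (ħ : ℝ), 0 < ħ → ħ ≤ 1 → ∀ t : ℝ,
          ‖evalTH (c m) t ħ‖ ≤ C * (1 + |t|) ^ l * ħ ^ hbarOrder m) ∧
        ∀ (ħ : ℝ) (hħ : 0 < ħ), ħ ≤ 1 → ∀ t : ℝ,
          eLpNorm (expansionError N q c (N * l) ħ hħ t) 2 volume ≤
            ENNReal.ofReal (C * (|t| * ħ) ^ (l + 1)) ∧
          eLpNorm (expansionError N q c (2 * l) ħ hħ t) 2 volume ≤
            ENNReal.ofReal (C * (|t| * max 1 (|t| ^ l) * ħ ^ (l + 1))) := by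
  obtain ⟨κ, hκ, hκ21, hκexp⟩ := exists_dilGen_pow_expansion
  obtain ⟨E, hE0, hE⟩ := exists_stateCoeff_bound hκ hκ21 N l K
  set Z := ∑ s ∈ Finset.range (N * (l + 1) + 1), ‖schwartzToL2 ((dilGen ^ s) (hermiteS 0))‖ with hZ
  set G := ∑ m ∈ Finset.range (N * l + 1), ‖schwartzToL2 (hermiteS (2 * m))‖ with hG
  have hZ0 : 0 ≤ Z := Finset.sum_nonneg fun _ _ => norm_nonneg _
  have hG0 : 0 ≤ G := Finset.sum_nonneg fun _ _ => norm_nonneg _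
  -- The summands give positivity, the coefficient bound, the Taylor remainder and the truncated
  -- tail, in this order.
  refine ⟨1 + l * E + E * Z + l * E * G, by positivity, fun q hq =>
    ⟨expansionCoeff κ N q l, fun m hm => expansionCoeff_eq_zero hκ q hm,
      natDegree_expansionCoeff_le κ N q l, fun m ħ h0 h1 t => ?_, fun ħ hħ h1 t => ?_⟩⟩
  · obtain ⟨-, hst⟩ := hE q hq ħ h0 h1
    refine (norm_evalTH_expansionCoeff_le (T := (1 + |t|) ^ l) (B := E * ħ ^ hbarOrder m)
      (fun j hj => ?_) fun j hj => (hst j hj m).2).trans ?_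
    · calc |t| ^ (j + 1) ≤ (1 + |t|) ^ (j + 1) := by gcongr; linarith
        _ ≤ (1 + |t|) ^ l := pow_le_pow_right₀ (by linarith [abs_nonneg t]) hj
    · calc (l : ℝ) * ((1 + |t|) ^ l * (E * ħ ^ hbarOrder m))
          = (l * E) * ((1 + |t|) ^ l * ħ ^ hbarOrder m) := by ring
        _ ≤ (1 + l * E + E * Z + l * E * G) * ((1 + |t|) ^ l * ħ ^ hbarOrder m) := by
            gcongr
            nlinarith [mul_nonneg hE0 hZ0, mul_nonneg (mul_nonneg l.cast_nonneg hE0) hG0]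
        _ = _ := by ring
  · obtain ⟨hlast, hst⟩ := hE q hq ħ hħ h1
    have hmain := norm_schrodingerGroup_sub_taylorState_le hN q hħ
      (dilS (Real.log ħ / 2) (hermiteS 0)) l t
    have hrem : ‖schwartzToL2 (aeval dilGen (((polyQ N q ħ 2).map Complex.ofRealHom) ^ (l + 1))
        (dilS (Real.log ħ / 2) (hermiteS 0)))‖ ≤ E * Z * ħ ^ (l + 1) := by
      have hdeg : (polyQ N q ħ 2 ^ (l + 1)).natDegree < N * (l + 1) + 1 := by
        refine Nat.lt_succ_of_le (natDegree_pow_le.trans ?_)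
        rw [mul_comm]
        exact Nat.mul_le_mul_right _ (natDegree_polyQ_le N q ħ 2)
      rw [aeval_dilGen_dilS, norm_dilS, ← Polynomial.map_pow,
        aeval_eq_sum_range' (natDegree_map_le.trans_lt hdeg), LinearMap.sum_apply, map_sum]
      refine (norm_sum_le _ _).trans ?_
      rw [hZ, mul_assoc, mul_comm _ (ħ ^ (l + 1)), ← mul_assoc, Finset.mul_sum]
      refine Finset.sum_le_sum fun s _ => ?_
      rw [LinearMap.smul_apply, map_smul, norm_smul, coeff_map, Complex.ofRealHom_eq_coe,
        Complex.norm_real, Real.norm_eq_abs]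
      exact mul_le_mul_of_nonneg_right (hlast s) (norm_nonneg _)
    rw [taylorState_eq hκexp] at hmain
    set V := schrodingerGroup ħ (symbolQ N q ħ) t
      (schwartzToL2 (dilS (Real.log ħ / 2) (hermiteS 0))) with hV
    let f : ℕ → SchwartzMap ℝ ℂ := fun m => evalTH (expansionCoeff κ N q l m) t ħ •
      dilS (t * coeffQ N q ħ 1) (dilS (Real.log ħ / 2) (hermiteS (2 * m)))
    set w := dilS (t * coeffQ N q ħ 1) (dilS (Real.log ħ / 2) (hermiteS 0)) with hw
    have hfirst : ‖V - schwartzToL2 (w + ∑ m ∈ Finset.range (N * l + 1), f m)‖ ≤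
        E * Z * (|t| * ħ) ^ (l + 1) := by
      refine (hmain.trans (mul_le_mul_of_nonneg_left hrem (by positivity))).trans
        (le_of_eq ?_)
      rw [mul_pow]
      ring
    have htail : ‖schwartzToL2 (∑ m ∈ Finset.range (N * l + 1), f m) -
        schwartzToL2 (∑ m ∈ Finset.range (2 * l + 1), f m)‖ ≤
        l * E * G * (|t| * max 1 (|t| ^ l) * ħ ^ (l + 1)) := by
      -- If `Nl ≤ 2l`, the extra coefficients vanish and the two sums agree.
      rcases le_or_gt (N * l) (2 * l) with hle | hlt
      · have heq : ∑ m ∈ Finset.range (N * l + 1), f m = ∑ m ∈ Finset.range (2 * l + 1), f m := by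
          refine Finset.sum_subset (Finset.range_mono (by omega)) fun m _ hm => ?_
          have hm' : N * l < m := by
            have := Finset.mem_range.not.1 hm
            omega
          simp only [f, expansionCoeff_eq_zero hκ q hm', evalTH, evalEval_zero, zero_smul]
        rw [heq, sub_self, norm_zero]
        positivity
      · rw [← map_sub, ← Finset.sum_Ico_eq_sub f (by omega : 2 * l + 1 ≤ N * l + 1), map_sum]
        refine (norm_sum_le _ _).trans ?_
        have hsub : Finset.Ico (2 * l + 1) (N * l + 1) ⊆ Finset.range (N * l + 1) := fun m hm =>
          Finset.mem_range.2 (Finset.mem_Ico.1 hm).2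
        calc ∑ m ∈ Finset.Ico (2 * l + 1) (N * l + 1), ‖schwartzToL2 (f m)‖
            ≤ ∑ m ∈ Finset.Ico (2 * l + 1) (N * l + 1),
              (l * E * (|t| * max 1 (|t| ^ l) * ħ ^ (l + 1))) *
                ‖schwartzToL2 (hermiteS (2 * m))‖ := by
              refine Finset.sum_le_sum fun m hm => ?_
              have hm' := (Finset.mem_Ico.1 hm).1
              simp only [f]
              rw [map_smul, norm_smul, norm_dilS, norm_dilS]
              refine mul_le_mul_of_nonneg_right ?_ (norm_nonneg _)
              refine (norm_evalTH_expansionCoeff_le (T := |t| * max 1 (|t| ^ l))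
                (B := E * ħ ^ (l + 1))
                (fun j hj => pow_succ_le_mul_max (abs_nonneg t) hj.le) fun j hj => ?_).trans
                (le_of_eq (by ring))
              -- Here `m ≥ 2l + 1` and `j + 1 ≤ l`, so the exponent `m - (j + 1)` is at least `l +
              -- 1`.
              refine (hst j hj m).1.trans ?_
              exact mul_le_mul_of_nonneg_left
                (pow_le_pow_of_le_one hħ.le h1 (by omega)) hE0
          _ ≤ ∑ m ∈ Finset.range (N * l + 1),
              (l * E * (|t| * max 1 (|t| ^ l) * ħ ^ (l + 1))) *
                ‖schwartzToL2 (hermiteS (2 * m))‖ :=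
              Finset.sum_le_sum_of_subset_of_nonneg hsub fun _ _ _ => by positivity
          _ = l * E * G * (|t| * max 1 (|t| ^ l) * ħ ^ (l + 1)) := by
              rw [← Finset.mul_sum, hG]
              ring
    have hlE : 0 ≤ (l : ℝ) * E := by positivity
    have hEZ : 0 ≤ E * Z := by positivity
    have hlEG : 0 ≤ l * E * G := by positivity
    constructor
    · rw [eLpNorm_expansionError]
      refine ENNReal.ofReal_le_ofReal (hfirst.trans ?_)
      gcongr
      linarith
    · rw [eLpNorm_expansionError]
      refine ENNReal.ofReal_le_ofReal ?_
      have hsplit : V - schwartzToL2 (w + ∑ m ∈ Finset.range (2 * l + 1), f m) =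
          (V - schwartzToL2 (w + ∑ m ∈ Finset.range (N * l + 1), f m)) +
          (schwartzToL2 (∑ m ∈ Finset.range (N * l + 1), f m) -
            schwartzToL2 (∑ m ∈ Finset.range (2 * l + 1), f m)) := by
        rw [map_add, map_add]
        abel
      have hfirst' : E * Z * (|t| * ħ) ^ (l + 1) ≤
          E * Z * (|t| * max 1 (|t| ^ l) * ħ ^ (l + 1)) := by
        rw [mul_pow]
        have := pow_succ_le_mul_max (abs_nonneg t) (le_refl l)
        gcongr
      have hnn : 0 ≤ |t| * max 1 (|t| ^ l) * ħ ^ (l + 1) := by positivity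
      calc ‖V - schwartzToL2 (w + ∑ m ∈ Finset.range (2 * l + 1), f m)‖
          ≤ E * Z * (|t| * max 1 (|t| ^ l) * ħ ^ (l + 1)) +
            l * E * G * (|t| * max 1 (|t| ^ l) * ħ ^ (l + 1)) := by
            rw [hsplit]
            exact (norm_add_le _ _).trans (add_le_add (hfirst.trans hfirst') htail)
        _ = (E * Z + l * E * G) * (|t| * max 1 (|t| ^ l) * ħ ^ (l + 1)) := by ring
        _ ≤ _ := mul_le_mul_of_nonneg_right (by linarith) hnn

end NormalFormPropagation

end

theorem mainTheorem3 (N : ℕ) (hN : 1 ≤ N) (l : ℕ) (K : ℝ) :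
    ∃ C : ℝ, 0 < C ∧
      ∀ q : ℕ → ℕ → ℝ,
        (∀ α i : ℕ, 2 ≤ α → α ≤ N → i ≤ N → |q α i| ≤ K) →
        ∃ c : ℕ → Polynomial (Polynomial ℂ),
          (∀ m : ℕ, N * l < m → c m = 0) ∧
          (∀ m : ℕ, (c m).natDegree ≤ l) ∧
          (∀ (m : ℕ) (ħ : ℝ), 0 < ħ → ħ ≤ 1 → ∀ t : ℝ,
            ‖NormalFormPropagation.evalTH (c m) t ħ‖ ≤
              C * (1 + |t|) ^ l * ħ ^ NormalFormPropagation.hbarOrder m) ∧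
          ∀ (ħ : ℝ) (hħ : 0 < ħ), ħ ≤ 1 →
            NormalFormPropagation.IsSchrodingerGroup ħ (NormalFormPropagation.symbolQ N q ħ)
              (NormalFormPropagation.schrodingerGroup ħ
                (NormalFormPropagation.symbolQ N q ħ)) ∧
            ∀ t : ℝ,
              MeasureTheory.eLpNorm
                (NormalFormPropagation.expansionError N q c (N * l) ħ hħ t) 2
                MeasureTheory.volume ≤ ENNReal.ofReal (C * (|t| * ħ) ^ (l + 1)) ∧
              MeasureTheory.eLpNorm
                (NormalFormPropagation.expansionError N q c (2 * l) ħ hħ t) 2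
                MeasureTheory.volume ≤
                  ENNReal.ofReal (C * (|t| * max 1 (|t| ^ l) * ħ ^ (l + 1))) := by
  obtain ⟨C, hC, h⟩ := NormalFormPropagation.exists_expansion hN l K
  refine ⟨C, hC, fun q hq => ?_⟩
  obtain ⟨c, hc0, hdeg, hbound, herr⟩ := h q hq
  exact ⟨c, hc0, hdeg, hbound, fun ħ hħ h1 =>
    ⟨NormalFormPropagation.isSchrodingerGroup_schrodingerGroup N q hħ, herr ħ hħ h1⟩⟩
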